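/- Let $\mathbb D\in\{\mathbb R,\mathbb T\}$ with $\mathbb T=\mathbb R/2\pi\mathbb Z$, and let $V,f:\mathbb D^d\to\mathbb R$ be smooth, with $\mathrm e^{-V}$ Lebesgue integrable and $f$ integrable with respect to $\mu=\mathrm e^{-V}/Z$, $Z=\int_{\mathbb D^d}\mathrm e^{-V}$. Put $I=\int f\,\mathrm d\mu$. For $U:\mathbb D^d\to\mathbb R$ put $Z[U]=\int_{\mathbb D^d}\mathrm e^{-V-U}$, $\mu_U=\mathrm e^{-V-U}/Z[U]$, $\mathcal L_U=\Delta-\nabla(V+U)\cdot\nabla$, $L^2_0(\mu_U)=\{\varphi\in L^2(\mu_U):\int\varphi\,\mathrm d\mu_U=0\}$, and let $H^1(\mu_U)$ be the set of $\varphi\in L^2(\mu_U)$ with weak gradient in $L^2(\mu_U)^d$. A weak solution of $-\mathcal L_U u=h$ is a function $u\in H^1(\mu_U)\cap L^2_0(\mu_U)$ such that $\int\nabla u\cdot\nabla\varphi\,\mathrm d\mu_U=\int h\,\varphi\,\mathrm d\mu_U$ for all $\varphi\in H^1(\mu_U)\cap L^2_0(\mu_U)$. Let $\mathfrak U_0$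 be the set of smooth $U:\mathbb D^d\to\mathbb R$ such that $\mathrm e^{-V-U}$ is Lebesgue integrable, $(f-I)\mathrm e^U\in L^2(\mu_U)$, and $\mu_U$ satisfies a Poincaré inequality: for some $R>0$, $\|\varphi\|_{L^2(\mu_U)}^2\le \frac1R\|\nabla\varphi\|_{L^2(\mu_U)}^2$ for all $\varphi\in H^1(\mu_U)\cap L^2_0(\mu_U)$. Define $$\sigma^2_f[U]=\frac{2Z[U]^2}{Z^2}\int_{\mathbb D^d}|\nabla\phi_U|^2\,\mathrm d\mu_U,$$ where $\phi_U$ is the weak solution of $-\mathcal L_U\phi_U=(f-I)\mathrm e^U$ (with $\sigma_f^2[U]=0$ by convention if there is none). For a functional $E$, let $\mathrm dE[U]\cdot\delta U=\lim_{\varepsilon\to0}\varepsilon^{-1}(E[U+\varepsilon\,\delta U]-E[U])$. **Proposition.** Let $U\in\mathfrak U_0$. The weak solution $\phi_U$ exists and is unique. For $\delta X\in C_c^\infty(\mathbb D^d)$ put $\delta X_0=\delta X-\int\delta X\,\mathrm d\mu_U$; there is a unique weak solution $\psi_{U,\delta X_0}$ of $$-\mathcal L_U\psi_{U,\delta X_0}=(f-I)\mathrm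 e^U\delta X_0-\nabla(\delta X_0)\cdot\nabla\phi_U .$$ For all $\delta U,\delta W\in C_c^\infty(\mathbb D^d)$, the derivative $\mathrm d\sigma_f^2[U+\varepsilon\,\delta W]\cdot\delta U$ exists for every $\varepsilon\in\mathbb R$, the second variation exists, and $$\begin{aligned}\tfrac12\,\mathrm d\bigl(\mathrm d\sigma^2_f[U]\cdot\delta U\bigr)\cdot\delta W={}&\frac{Z[U]}{Z^2}\int_{\mathbb D^d}\delta U_0\,\delta W_0\Bigl(|\nabla\phi_U|^2+\int_{\mathbb D^d}|\nabla\phi_U|^2\,\mathrm d\mu_U\Bigr)\mathrm e^{-V-U}\\&-\frac{2Z[U]}{Z^2}\int_{\mathbb D^d}\bigl(\nabla\psi_{U,\delta U_0}-\delta U_0\nabla\phi_U\bigr)\cdot\bigl(\nabla\psi_{U,\delta W_0}-\delta W_0\nabla\phi_U\bigr)\mathrm e^{-V-U}.\end{aligned}$$ If $d=1$ and $\mathbb D=\mathbb R$, the second term on the right-hand side is zero, and $\sigma^2_f$ is a convex functional: for all $U_0,U_1\in\mathfrak U_0$ and $t\in[0,1]$, $$\sigma_f^2[(1-t)U_0+tU_1]\le(1-t)\,\sigma_f^2[U_0]+t\,\sigma_f^2[U_1].$$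 -/

import Mathlib

open MeasureTheory
open scoped ContDiff

noncomputable section

/-- The Euclidean space `ℝ^d`. -/
abbrev Space (d : ℕ) : Type := EuclideanSpace ℝ (Fin d)

/-- The two possible one-dimensional factors of the configuration space `𝔻^d`: the real line
`𝔻 = ℝ`, or the torus `𝔻 = ℝ / 2πℤ`. Functions on `(ℝ / 2πℤ)^d` are handled as functions on
`ℝ^d` that are `2π`-periodic in each coordinate. -/
inductive Factor : Type
  | line : Factor
  | torus : Factor

namespace Factor

/-- `u` is a function on `𝔻^d` (no condition if `𝔻 = ℝ`, periodicity if `𝔻 = ℝ / 2πℤ`). -/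
def IsFunction {d : ℕ} {β : Type} (D : Factor) (u : Space d → β) : Prop :=
  match D with
  | line => True
  | torus => ∀ (i : Fin d) (x : Space d),
      u (x + EuclideanSpace.single i (2 * Real.pi)) = u x

/-- Lebesgue measure on `𝔻^d`: on the torus, Lebesgue measure on the fundamental cube
`[-π, π)^d`. -/
def leb (D : Factor) (d : ℕ) : Measure (Space d) :=
  match D with
  | line => volume
  | torus => volume.restrict {x : Space d | ∀ i, x i ∈ Set.Ico (-Real.pi) Real.pi}

/-- The smooth functions on `𝔻^d`. -/
structure IsSmooth {d : ℕ} (D : Factor) (u : Space d → ℝ) : Prop where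
  isFunction : D.IsFunction u
  contDiff : ContDiff ℝ ∞ u

/-- The class `C_c^∞(𝔻^d)`; compactness of the support is automatic on the torus. -/
structure IsTest {d : ℕ} (D : Factor) (χ : Space d → ℝ) : Prop where
  isSmooth : D.IsSmooth χ
  hasCompactSupport : D = line → HasCompactSupport χ

end Factor

variable {d : ℕ}

/-- The normalization constant `∫_{𝔻^d} e^{-W}`. -/
def partitionFunction (D : Factor) (W : Space d → ℝ) : ℝ :=
  ∫ x, Real.exp (-W x) ∂(D.leb d)

/-- The measure `e^{-W} / ∫ e^{-W}` on `𝔻^d`. Thus `μ = gibbs D V` and `μ_U = gibbs D (V + U)`. -/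
def gibbs (D : Factor) (W : Space d → ℝ) : Measure (Space d) :=
  (D.leb d).tilted (fun x => -W x)

/-- `u ∈ H¹(μ_W)` with weak gradient `g`, where `μ_W = gibbs D W`. For continuous `W`, functions
in `L²(μ_W)` are square integrable on bounded sets, so the two integrals in `weak_gradient` are
convergent. -/
structure MemH1 (D : Factor) (W : Space d → ℝ) (u : Space d → ℝ) (g : Space d → Space d) :
    Prop where
  isFunction : D.IsFunction u
  isFunction_grad : D.IsFunction g
  memLp : MemLp u 2 (gibbs D W)
  memLp_grad : MemLp g 2 (gibbs D W)
  weak_gradient : ∀ χ : Space d → ℝ, D.IsTest χ →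
    ∫ x, u x • gradient χ x ∂(D.leb d) = -∫ x, χ x • g x ∂(D.leb d)

/-- `u ∈ H¹(μ_W) ∩ L²₀(μ_W)` with weak gradient `g`. -/
structure MemH1Zero (D : Factor) (W : Space d → ℝ) (u : Space d → ℝ) (g : Space d → Space d) :
    Prop where
  memH1 : MemH1 D W u g
  integral_eq_zero : ∫ x, u x ∂(gibbs D W) = 0

/-- The Poincaré inequality for `μ_W`. -/
def Poincare (D : Factor) (W : Space d → ℝ) : Prop :=
  ∃ R : ℝ, 0 < R ∧ ∀ (u : Space d → ℝ) (g : Space d → Space d), MemH1Zero D W u g →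
    ∫ x, u x ^ 2 ∂(gibbs D W) ≤ 1 / R * ∫ x, ‖g x‖ ^ 2 ∂(gibbs D W)

/-- `u`, with weak gradient `g`, is a weak solution in `H¹(μ_W) ∩ L²₀(μ_W)` of
`-Δu + ∇W · ∇u = h`, that is, of `-e^W ∇ · (e^{-W} ∇u) = h`. -/
structure IsWeakSolution (D : Factor) (W h : Space d → ℝ) (u : Space d → ℝ)
    (g : Space d → Space d) : Prop where
  memH1Zero : MemH1Zero D W u g
  weak_formulation : ∀ (χ : Space d → ℝ) (k : Space d → Space d), MemH1Zero D W χ k →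
    ∫ x, inner ℝ (g x) (k x) ∂(gibbs D W) = ∫ x, h x * χ x ∂(gibbs D W)

/-- There is exactly one weak solution of `-e^W ∇ · (e^{-W} ∇u) = h` in `H¹(μ_W) ∩ L²₀(μ_W)`, as
a class of functions modulo equality almost everywhere. -/
def WellPosed (D : Factor) (W h : Space d → ℝ) : Prop :=
  (∃ (u : Space d → ℝ) (g : Space d → Space d), IsWeakSolution D W h u g) ∧
  ∀ (u u' : Space d → ℝ) (g g' : Space d → Space d),
    IsWeakSolution D W h u g → IsWeakSolution D W h u' g' →
      u =ᵐ[D.leb d] u' ∧ g =ᵐ[D.leb d] g'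

/-- The standing assumptions on the potential `V` and the observable `f`. -/
structure IsTargetPair (D : Factor) (V f : Space d → ℝ) : Prop where
  smooth_potential : D.IsSmooth V
  integrable_exp : Integrable (fun x => Real.exp (-V x)) (D.leb d)
  smooth_observable : D.IsSmooth f
  integrable_observable : Integrable f (gibbs D V)

/-- The centred observable `f - I`, with `I = ∫ f dμ`. -/
def centredObservable (D : Factor) (V f : Space d → ℝ) : Space d → ℝ :=
  fun x => f x - ∫ y, f y ∂(gibbs D V)

/-- The right-hand side `(f - I) e^U` of the Poisson equation. -/
def poissonSource (D : Factor) (V f U : Space d → ℝ) : Space d → ℝ :=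
  fun x => centredObservable D V f x * Real.exp (U x)

/-- The admissible biasing potentials `𝔘₀(V, f)`. -/
structure IsAdmissible (D : Factor) (V f U : Space d → ℝ) : Prop where
  smooth : D.IsSmooth U
  integrable_exp : Integrable (fun x => Real.exp (-(V + U) x)) (D.leb d)
  poincare : Poincare D (V + U)
  memLp_source : MemLp (poissonSource D V f U) 2 (gibbs D (V + U))

/-- `u = φ_U`, with weak gradient `g = ∇φ_U`: the solution in `H¹(μ_U) ∩ L²₀(μ_U)` of
`-𝓛_U φ_U = (f - I) e^U`, where `𝓛_U = Δ - ∇(V + U) · ∇`. -/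
def IsPoissonSolution (D : Factor) (V f U : Space d → ℝ) (u : Space d → ℝ)
    (g : Space d → Space d) : Prop :=
  IsWeakSolution D (V + U) (poissonSource D V f U) u g

open Classical in
/-- The asymptotic variance `σ²_f[U] = 2 Z[U]² / Z² ∫ |∇φ_U|² dμ_U`, where `φ_U` is the solution
of the Poisson equation (it exists and is unique whenever `U ∈ 𝔘₀(V, f)`). -/
def asymptoticVariance (D : Factor) (V f U : Space d → ℝ) : ℝ :=
  if hex : ∃ p : (Space d → ℝ) × (Space d → Space d), IsPoissonSolution D V f U p.1 p.2 then
    2 * partitionFunction D (V + U) ^ 2 / partitionFunction D V ^ 2 *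
      ∫ x, ‖hex.choose.2 x‖ ^ 2 ∂(gibbs D (V + U))
  else 0

/-- The centred perturbation `δX₀ = δX - μ_U(δX)`. -/
def centre (D : Factor) (V U X : Space d → ℝ) : Space d → ℝ :=
  fun x => X x - ∫ y, X y ∂(gibbs D (V + U))

/-- The right-hand side `(f - I) e^U X - ∇X · ∇φ_U` of the perturbed Poisson equation in the
direction `X`, where `g = ∇φ_U`. -/
def perturbedSource (D : Factor) (V f U : Space d → ℝ) (g : Space d → Space d)
    (X : Space d → ℝ) : Space d → ℝ :=
  fun x => poissonSource D V f U x * X x - inner ℝ (gradient X x) (g x)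

/-- The positive weighted term of the second variation, where `g = ∇φ_U` and `X`, `Y` are the
centred perturbations. -/
def weightedTerm (D : Factor) (V U : Space d → ℝ) (g : Space d → Space d)
    (X Y : Space d → ℝ) : ℝ :=
  partitionFunction D (V + U) / partitionFunction D V ^ 2 *
    ∫ x, X x * Y x * (‖g x‖ ^ 2 + ∫ y, ‖g y‖ ^ 2 ∂(gibbs D (V + U))) *
      Real.exp (-(V + U) x) ∂(D.leb d)

/-- The subtracted term of the second variation, where `g = ∇φ_U`, `X`, `Y` are the centred
perturbations and `k = ∇ψ_{U,X}`, `l = ∇ψ_{U,Y}`. -/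
def gradientTerm (D : Factor) (V U : Space d → ℝ) (g : Space d → Space d)
    (X Y : Space d → ℝ) (k l : Space d → Space d) : ℝ :=
  2 * partitionFunction D (V + U) / partitionFunction D V ^ 2 *
    ∫ x, inner ℝ (k x - X x • g x) (l x - Y x • g x) * Real.exp (-(V + U) x) ∂(D.leb d)

end

/-! Fix an admissible `U` and let `H` be the Hilbert space `H¹(μ_U) ∩ L²₀(μ_U)`. A bounded
continuous `a` defines an operator `A_a` on `H` by `⟪A_a p, q⟫ = ∫ a ∇p · ∇q dμ_U`. It is linear in
`a` and symmetric, and by the Poincaré inequality it is invertible as soon as `a ≥ c > 0`.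

For a bounded smooth perturbation `b`, the source pairs with a test function through `(f - I)
e^{U+b} e^{-V-U-b} = (f - I) e^{-V}`, where `U` and `b` have cancelled. The zero-mean conditions for
`μ_U` and `μ_{U+b}` differ by a constant, which is harmless because `∫ (f - I) e^{-V} = 0`. Hence
one vector `r` of `H` represents the source for all `b`, and `σ²[U + b] = (2 Z[U]² / Z²) ·
μ_U(e^{-b}) · ⟪r, A_{e^{-b}}⁻¹ r⟫` (`asymptoticVariance_add`). This is a smooth function of `e^{-b}`
in a commutative Banach algebra, so both variations reduce to differentiating an operator inverse
(`hasDerivAt_weightedDualEnergyDeriv`).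

Testing the equation of `φ_U` against `X v` shows that the perturbed source is the functional `A_X
φ_U` (`integral_perturbedSource_mul`). So `A_1 ψ_X = A_X φ_U`: the field `∇ψ_X` is the `L²(μ_U)`
projection of `X ∇φ_U` on gradients. The stated formula follows by algebra in the centred directions
(`secondVariation_eq`).

On the line with `d = 1`, every test field is the gradient of a bounded function, so the residual
`∇ψ_X - X ∇φ_U` vanishes. For the same reason the flux `J = φ_U' e^{-V-U}`, which solves `-J' = (f -
I) e^{-V}`, does not depend on `U` (`flux_ae_eq`). With `W = V + U`, the variance is `2 / Z²` times
the double integral of `J(y)² e^{W(y) - W(x)}`, whose integrand is convex in `W`. -/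

open scoped BoundedContinuousFunction

noncomputable section

/-! ### Differentiation of the weighted dual energy in an abstract Hilbert space -/

section DualEnergy

variable {𝔸 H : Type*} [NormedCommRing 𝔸] [NormedAlgebra ℝ 𝔸]
  [NormedAddCommGroup H] [InnerProductSpace ℝ H] [CompleteSpace H]

/-- The weighted dual energy `mass a * ⟪r, (form a)⁻¹ r⟫`. -/
def weightedDualEnergy (mass : 𝔸 →L[ℝ] ℝ) (form : 𝔸 →L[ℝ] H →L[ℝ] H) (r : H) (a : 𝔸) : ℝ :=
  mass a * inner ℝ r (Ring.inverse (form a) r)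

/-- The derivative of `weightedDualEnergy` at `a` in the direction `b`. -/
def weightedDualEnergyDeriv (mass : 𝔸 →L[ℝ] ℝ) (form : 𝔸 →L[ℝ] H →L[ℝ] H) (r : H)
    (a b : 𝔸) : ℝ :=
  mass b * inner ℝ r (Ring.inverse (form a) r) -
    mass a * inner ℝ r (Ring.inverse (form a) (form b (Ring.inverse (form a) r)))

theorem HasDerivAt.ringInverse_clm {T : ℝ → H →L[ℝ] H} {T' : H →L[ℝ] H} {t : ℝ}
    (hT : HasDerivAt T T' t) (hu : IsUnit (T t)) :
    HasDerivAt (fun s => Ring.inverse (T s))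
      (-(Ring.inverse (T t) * T' * Ring.inverse (T t))) t := by
  obtain ⟨u, hu⟩ := hu
  have h := hasFDerivAt_ringInverse (𝕜 := ℝ) u
  rw [hu] at h
  have h2 := h.comp_hasDerivAt t hT
  have h3 : Ring.inverse (T t) = ↑u⁻¹ := by rw [← hu, Ring.inverse_unit]
  rw [h3]
  simpa [Function.comp_def] using h2

theorem hasDerivAt_weightedDualEnergy (mass : 𝔸 →L[ℝ] ℝ) (form : 𝔸 →L[ℝ] H →L[ℝ] H) (r : H)
    {c : ℝ → 𝔸} {c' : 𝔸} {t : ℝ} (hc : HasDerivAt c c' t) (hu : IsUnit (form (c t))) :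
    HasDerivAt (fun s => weightedDualEnergy mass form r (c s))
      (weightedDualEnergyDeriv mass form r (c t) c') t := by
  have h1 := mass.hasFDerivAt.comp_hasDerivAt t hc
  have h2 := (form.hasFDerivAt.comp_hasDerivAt t hc).ringInverse_clm hu
  have h3 := (innerSL ℝ r).hasFDerivAt.comp_hasDerivAt t
    (h2.clm_apply (hasDerivAt_const t r))
  convert! h1.mul h3 using 1
  simp [weightedDualEnergyDeriv, sub_eq_add_neg]

/-- The model case is `e s = exp (-s w)`, for which `-(e s * u)` is the derivative of `exp (-s w - t
u)` in `t` at `0`. With the source written as `form 1 γ`, every inverse at `s = 0` can be evaluated: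
it sends the source to `γ` and `form w γ` to `η`, and symmetry moves the outermost one onto the
source. Differentiating the two inverses in the quadratic term gives the same number `⟪form u γ,
η⟫`, hence the factor `2`. -/
theorem hasDerivAt_weightedDualEnergyDeriv (mass : 𝔸 →L[ℝ] ℝ) (form : 𝔸 →L[ℝ] H →L[ℝ] H)
    (hsymm : ∀ a x y, inner ℝ (form a x) y = inner ℝ x (form a y))
    {e : ℝ → 𝔸} {w : 𝔸} (he : HasDerivAt e (-w) 0) (he0 : e 0 = 1) (hu : IsUnit (form 1))
    (hmass : mass 1 = 1) {γ η : H} (hη : form 1 η = form w γ) (u : 𝔸) :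
    HasDerivAt (fun s => weightedDualEnergyDeriv mass form (form 1 γ) (e s) (-(e s * u)))
      (mass (u * w) * inner ℝ (form 1 γ) γ - mass u * inner ℝ (form w γ) γ
        - mass w * inner ℝ (form u γ) γ - inner ℝ (form (u * w) γ) γ
        + 2 * inner ℝ (form u γ) η) 0 := by
  have hmul : HasDerivAt (fun s => -(e s * u)) (w * u) 0 := by
    convert! (he.mul_const u).neg using 1
    simp
  have hinv : ∀ x, Ring.inverse (form 1) (form 1 x) = x := fun x => by
    have := Ring.inverse_mul_cancel (form 1) hu
    exact congrArg (fun S : H →L[ℝ] H => S x) this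
  have hinv' : ∀ x, form 1 (Ring.inverse (form 1) x) = x := fun x => by
    have := Ring.mul_inverse_cancel (form 1) hu
    exact congrArg (fun S : H →L[ℝ] H => S x) this
  have hadj : ∀ x, inner ℝ (form 1 γ) (Ring.inverse (form 1) x) = inner ℝ γ x := fun x => by
    rw [hsymm, hinv']
  have hR := (form.hasFDerivAt.comp_hasDerivAt (0 : ℝ) he).ringInverse_clm
    (by simpa [he0] using hu)
  have hR1 := hR.clm_apply (hasDerivAt_const (0 : ℝ) (form 1 γ))
  have hm1 := mass.hasFDerivAt.comp_hasDerivAt (0 : ℝ) hmul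
  have hm2 := mass.hasFDerivAt.comp_hasDerivAt (0 : ℝ) he
  have hf1 := form.hasFDerivAt.comp_hasDerivAt (0 : ℝ) hmul
  have h1 := hm1.mul ((innerSL ℝ (form 1 γ)).hasFDerivAt.comp_hasDerivAt (0 : ℝ) hR1)
  have h2 := hm2.mul ((innerSL ℝ (form 1 γ)).hasFDerivAt.comp_hasDerivAt (0 : ℝ)
    (hR.clm_apply (hf1.clm_apply hR1)))
  convert! h1.sub h2 using 1
  have hη' : Ring.inverse (form 1) (form w γ) = η := by rw [← hη, hinv]
  simp only [Function.comp_apply, he0, one_mul, hinv, map_neg, map_zero, add_zero, neg_mul,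
    mul_neg, neg_neg, neg_apply, mul_apply_eq_comp, hη',
    innerSL_apply_apply, hadj, map_add]
  have e1 : inner ℝ γ (form w (Ring.inverse (form 1) (form u γ))) = inner ℝ (form u γ) η := by
    rw [← hsymm, ← hη, hsymm, hinv', real_inner_comm]
  have e2 : inner ℝ γ (form u η) = inner ℝ (form u γ) η := (hsymm _ _ _).symm
  have e3 : inner ℝ (form 1 γ) η = inner ℝ (form w γ) γ := by
    rw [hsymm, hη, real_inner_comm]
  rw [e1, e2, mul_comm w u, e3, hmass, hsymm u, hsymm (u * w)]
  ring

end DualEnergy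

/-! ### Functions on `𝔻^d` -/

/-- The fundamental cube `[-π, π)^d`. -/
def fundamentalCube (d : ℕ) : Set (Space d) := {x | ∀ i, x i ∈ Set.Ico (-Real.pi) Real.pi}

/-- The representative of a point of `ℝ^d` in the fundamental cube. -/
def wrap (x : Space d) : Space d :=
  WithLp.toLp 2 fun i => toIcoMod Real.two_pi_pos (-Real.pi) (x i)

theorem wrap_mem (x : Space d) : wrap x ∈ fundamentalCube d := fun i => by
  have h := toIcoMod_mem_Ico Real.two_pi_pos (-Real.pi) (x i)
  have e : -Real.pi + 2 * Real.pi = Real.pi := by ring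
  rw [e] at h
  exact h

theorem wrap_eq_self {x : Space d} (hx : x ∈ fundamentalCube d) : wrap x = x := by
  ext i
  have h := hx i
  have e : -Real.pi + 2 * Real.pi = Real.pi := by ring
  exact (toIcoMod_eq_self Real.two_pi_pos).2 (by rw [e]; exact h)

theorem measurableSet_fundamentalCube : MeasurableSet (fundamentalCube d) := by
  have : fundamentalCube d = ⋂ i, (fun x : Space d => x i) ⁻¹' Set.Ico (-Real.pi) Real.pi := by
    ext x; simp [fundamentalCube]
  rw [this]
  exact MeasurableSet.iInter fun i => measurableSet_Ico.preimage (by fun_prop)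

theorem wrap_add_single (i : Fin d) (x : Space d) :
    wrap (x + EuclideanSpace.single i (2 * Real.pi)) = wrap x := by
  ext j
  by_cases h : j = i
  · subst h; simp [wrap]
  · simp [wrap, h]

namespace Factor

variable {D : Factor} {β : Type}

theorem IsFunction.apply_wrap {u : Space d → β} (hu : torus.IsFunction u) (x : Space d) :
    u (wrap x) = u x := by
  have key : ∀ (s : Finset (Fin d)) (n : Fin d → ℤ),
      Function.Periodic u (∑ i ∈ s, n i • EuclideanSpace.single i (2 * Real.pi)) := by
    intro s n
    induction s using Finset.induction_on with
    | empty => intro x; simp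
    | insert i s hi ih =>
      rw [Finset.sum_insert hi]
      exact Function.Periodic.add_period (Function.Periodic.zsmul (hu i) _) ih
  have h := key Finset.univ (fun i => toIcoDiv Real.two_pi_pos (-Real.pi) (x i)) (wrap x)
  rw [← h]
  congr 1
  ext j
  have := toIcoMod_add_toIcoDiv_zsmul Real.two_pi_pos (-Real.pi) (x j)
  simp only [PiLp.add_apply, WithLp.ofLp_sum, Finset.sum_apply, PiLp.smul_apply]
  rw [Finset.sum_eq_single j (fun k _ hk => by simp [Ne.symm hk]) (by simp)]
  simp [wrap]

/-- Classes in `L²` carry no periodicity, whereas `MemH1` demands it pointwise. Composition with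
`wrap` makes a representative periodic without changing it on the cube, where the measure lives. -/
theorem exists_isFunction_ae_eq (D : Factor) (u : Space d → β) :
    ∃ v : Space d → β, D.IsFunction v ∧ v =ᵐ[D.leb d] u := by
  cases D with
  | line => exact ⟨u, trivial, Filter.EventuallyEq.rfl⟩
  | torus =>
    refine ⟨fun x => u (wrap x), fun i x => by simp only [wrap_add_single], ?_⟩
    refine (ae_restrict_iff' measurableSet_fundamentalCube).2 (Filter.Eventually.of_forall ?_)
    intro x hx
    simp only [wrap_eq_self hx]

theorem isFunction_const (c : β) : D.IsFunction (fun _ : Space d => c) := by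
  cases D <;> simp [IsFunction]

theorem IsFunction.comp {γ : Type} {u : Space d → β} (hu : D.IsFunction u) (F : β → γ) :
    D.IsFunction (fun x => F (u x)) := by
  cases D with
  | line => trivial
  | torus => exact fun i x => congrArg F (hu i x)

theorem IsFunction.comp₂ {γ δ : Type} {u : Space d → β} {v : Space d → γ} (hu : D.IsFunction u)
    (hv : D.IsFunction v) (F : β → γ → δ) : D.IsFunction (fun x => F (u x) (v x)) := by
  cases D with
  | line => trivial
  | torus => exact fun i x => congrArg₂ F (hu i x) (hv i x)

theorem IsFunction.gradient {u : Space d → ℝ} (hu : D.IsFunction u) :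
    D.IsFunction (gradient u) := by
  cases D with
  | line => trivial
  | torus =>
    intro i x
    have h : (fun y => u (y + EuclideanSpace.single i (2 * Real.pi))) = u := funext (hu i)
    unfold _root_.gradient
    conv_rhs => rw [← h, fderiv_comp_add_right]

/-- On the torus all values are already taken on the fundamental cube, which lies in the closed ball
of radius `√d π`. -/
theorem IsFunction.exists_bound {F : Type} [NormedAddCommGroup F] {u : Space d → F}
    (hu : D.IsFunction u) (hc : Continuous u) (hs : D = line → HasCompactSupport u) :
    ∃ C, ∀ x, ‖u x‖ ≤ C := by
  cases D with
  | line => exact (hs rfl).exists_bound_of_continuous hc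
  | torus =>
    obtain ⟨C, hC⟩ := (ProperSpace.isCompact_closedBall (0 : Space d)
      (Real.sqrt d * Real.pi)).exists_bound_of_continuousOn hc.continuousOn
    refine ⟨C, fun x => ?_⟩
    rw [← hu.apply_wrap x]
    refine hC _ ?_
    have h : ∀ i, ‖wrap x i‖ ≤ Real.pi := fun i => by
      have := wrap_mem x i
      rw [Real.norm_eq_abs, abs_le]
      exact ⟨this.1, this.2.le⟩
    rw [mem_closedBall_zero_iff, EuclideanSpace.norm_eq]
    rw [Real.sqrt_le_left (by positivity), mul_pow, Real.sq_sqrt (by positivity)]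
    calc ∑ i, ‖wrap x i‖ ^ 2 ≤ ∑ _i : Fin d, Real.pi ^ 2 :=
          Finset.sum_le_sum fun i _ => by gcongr; exact h i
      _ = d * Real.pi ^ 2 := by simp

/-! ### Smooth functions and test functions -/

theorem isSmooth_const (c : ℝ) : D.IsSmooth (fun _ : Space d => c) :=
  ⟨isFunction_const c, contDiff_const⟩

theorem IsSmooth.add {u v : Space d → ℝ} (hu : D.IsSmooth u) (hv : D.IsSmooth v) :
    D.IsSmooth (fun x => u x + v x) :=
  ⟨hu.1.comp₂ hv.1 (· + ·), hu.2.add hv.2⟩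

theorem IsSmooth.sub {u v : Space d → ℝ} (hu : D.IsSmooth u) (hv : D.IsSmooth v) :
    D.IsSmooth (fun x => u x - v x) :=
  ⟨hu.1.comp₂ hv.1 (· - ·), hu.2.sub hv.2⟩

theorem IsSmooth.mul {u v : Space d → ℝ} (hu : D.IsSmooth u) (hv : D.IsSmooth v) :
    D.IsSmooth (fun x => u x * v x) :=
  ⟨hu.1.comp₂ hv.1 (· * ·), hu.2.mul hv.2⟩

theorem IsSmooth.continuous {u : Space d → ℝ} (hu : D.IsSmooth u) : Continuous u :=
  hu.2.continuous

theorem IsSmooth.differentiable {u : Space d → ℝ} (hu : D.IsSmooth u) : Differentiable ℝ u :=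
  hu.2.differentiable (by simp)

theorem IsSmooth.continuous_gradient {u : Space d → ℝ} (hu : D.IsSmooth u) :
    Continuous (_root_.gradient u) :=
  (InnerProductSpace.toDual ℝ (Space d)).symm.continuous.comp (hu.2.continuous_fderiv (by simp))

theorem IsTest.smooth_mul {u χ : Space d → ℝ} (hu : D.IsSmooth u) (hχ : D.IsTest χ) :
    D.IsTest (fun x => u x * χ x) :=
  ⟨hu.mul hχ.1, fun h => (hχ.2 h).mul_left⟩

theorem IsTest.exists_bound {χ : Space d → ℝ} (hχ : D.IsTest χ) : ∃ C, ∀ x, ‖χ x‖ ≤ C :=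
  hχ.1.1.exists_bound hχ.1.continuous hχ.2

theorem _root_.HasCompactSupport.gradient {χ : Space d → ℝ} (hχ : HasCompactSupport χ) :
    HasCompactSupport (_root_.gradient χ) :=
  (hχ.fderiv (𝕜 := ℝ)).comp_left (map_zero (InnerProductSpace.toDual ℝ (Space d)).symm)

theorem IsTest.hasCompactSupport_gradient {χ : Space d → ℝ} (hχ : D.IsTest χ) :
    D = line → HasCompactSupport (_root_.gradient χ) := fun h => (hχ.2 h).gradient

theorem IsTest.exists_bound_gradient {χ : Space d → ℝ} (hχ : D.IsTest χ) :
    ∃ C, ∀ x, ‖_root_.gradient χ x‖ ≤ C :=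
  hχ.1.1.gradient.exists_bound hχ.1.continuous_gradient hχ.hasCompactSupport_gradient

theorem gradient_mul {u v : Space d → ℝ} (hu : Differentiable ℝ u) (hv : Differentiable ℝ v)
    (x : Space d) : _root_.gradient (fun y => u y * v y) x =
      u x • _root_.gradient v x + v x • _root_.gradient u x := by
  unfold _root_.gradient
  rw [fderiv_fun_mul (hu x) (hv x)]
  simp

/-! ### Integration -/

instance (D : Factor) : IsFiniteMeasureOnCompacts (D.leb d) := by
  cases D with
  | line => exact inferInstanceAs (IsFiniteMeasureOnCompacts (volume : Measure (Space d)))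
  | torus => exact inferInstanceAs (IsFiniteMeasureOnCompacts (volume.restrict _))

instance (D : Factor) : SigmaFinite (D.leb d) := by
  cases D with
  | line => exact inferInstanceAs (SigmaFinite (volume : Measure (Space d)))
  | torus => exact inferInstanceAs (SigmaFinite (volume.restrict _))

theorem volume_preimage_cube : (volume : Measure (Space d)) (fundamentalCube d) =
    ENNReal.ofReal (2 * Real.pi) ^ d := by
  have h := (PiLp.volume_preserving_toLp (Fin d)).measure_preimage
    (measurableSet_fundamentalCube (d := d)).nullMeasurableSet
  have e : (@WithLp.toLp 2 (Fin d → ℝ)) ⁻¹' (fundamentalCube d) =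
      Set.pi Set.univ fun _ => Set.Ico (-Real.pi) Real.pi := by
    ext x; simp [fundamentalCube]
  rw [← h, e, Real.volume_pi_Ico]
  simp [two_mul]

instance (D : Factor) : NeZero (D.leb d) := by
  cases D with
  | line => exact inferInstanceAs (NeZero (volume : Measure (Space d)))
  | torus =>
    refine ⟨fun h => ?_⟩
    have h2 : (volume : Measure (Space d)) (fundamentalCube d) = 0 := by
      have := congrArg (fun m : Measure (Space d) => m Set.univ) h
      simpa [leb, fundamentalCube] using this
    rw [volume_preimage_cube] at h2
    have : (0 : ENNReal) < ENNReal.ofReal (2 * Real.pi) ^ d :=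
      ENNReal.pow_pos (ENNReal.ofReal_pos.2 Real.two_pi_pos) d
    exact this.ne' h2

theorem isFiniteMeasure_leb_torus : IsFiniteMeasure (torus.leb d) := by
  refine ⟨?_⟩
  have : torus.leb d Set.univ = volume (fundamentalCube d) := by
    simp [leb, fundamentalCube]
  rw [this, volume_preimage_cube]
  exact ENNReal.pow_lt_top ENNReal.ofReal_lt_top

theorem IsFunction.integrable {F : Type} [NormedAddCommGroup F] {u : Space d → F}
    (hu : D.IsFunction u) (hc : Continuous u) (hs : D = line → HasCompactSupport u) :
    Integrable u (D.leb d) := by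
  cases D with
  | line => exact hc.integrable_of_hasCompactSupport (hs rfl)
  | torus =>
    have := isFiniteMeasure_leb_torus (d := d)
    obtain ⟨C, hC⟩ := hu.exists_bound hc hs
    exact Integrable.of_bound hc.aestronglyMeasurable C (Filter.Eventually.of_forall hC)

/-- Divergence theorem on the closed box for the field whose only nonzero component is the `i`-th
one, equal to `u`. The contributions of the two opposite faces cancel by periodicity. -/
theorem setIntegral_fundamentalCube_fderiv_single {n : ℕ} {u : Space (n + 1) → ℝ}
    (hu : torus.IsSmooth u) (i : Fin (n + 1)) :
    ∫ x in fundamentalCube (n + 1), fderiv ℝ u x (EuclideanSpace.single i 1) = 0 := by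
  have e : (@WithLp.toLp 2 (Fin (n + 1) → ℝ)) ⁻¹' (fundamentalCube (n + 1)) =
      Set.pi Set.univ fun _ => Set.Ico (-Real.pi) Real.pi := by
    ext x; simp [fundamentalCube]
  rw [← (PiLp.volume_preserving_toLp (Fin (n + 1))).setIntegral_preimage_emb
    (MeasurableEquiv.toLp 2 _).measurableEmbedding, e, volume_pi,
    setIntegral_congr_set Measure.univ_pi_Ico_ae_eq_Icc, ← volume_pi]
  let L : (Fin (n + 1) → ℝ) →L[ℝ] Space (n + 1) :=
    (EuclideanSpace.equiv (Fin (n + 1)) ℝ).symm.toContinuousLinearMap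
  have hL : ∀ y, L y = WithLp.toLp 2 y := fun y => rfl
  let G : Fin (n + 1) → (Fin (n + 1) → ℝ) → ℝ := fun j y => if j = i then u (L y) else 0
  let G' : Fin (n + 1) → (Fin (n + 1) → ℝ) → (Fin (n + 1) → ℝ) →L[ℝ] ℝ := fun j y =>
    if j = i then (fderiv ℝ u (L y)).comp L else 0
  have hsum : ∀ y, ∑ j, G' j y (Pi.single j 1) =
      fderiv ℝ u (WithLp.toLp 2 y) (EuclideanSpace.single i 1) := by
    intro y
    rw [Finset.sum_eq_single i (fun j _ hj => by simp [G', hj]) (by simp)]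
    simp only [G', if_true, ContinuousLinearMap.comp_apply, hL]
    rfl
  have hcont : Continuous fun y : Fin (n + 1) → ℝ =>
      fderiv ℝ u (L y) (EuclideanSpace.single i 1) :=
    ((hu.2.continuous_fderiv (by simp)).comp L.continuous).clm_apply continuous_const
  have key := integral_divergence_of_hasFDerivAt_off_countable'
    (fun _ : Fin (n + 1) => -Real.pi) (fun _ => Real.pi)
    (fun _ => by have := Real.pi_pos; linarith) G G' ∅ Set.countable_empty
    (fun j => by
      by_cases hj : j = i
      · simp only [G, hj, if_true]
        exact (hu.continuous.comp L.continuous).continuousOn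
      · simp only [G, hj, if_false]
        exact continuousOn_const)
    (fun y _ j => by
      by_cases hj : j = i
      · simp only [G, G', hj, if_true]
        exact (hu.differentiable (L y)).hasFDerivAt.comp y L.hasFDerivAt
      · simp only [G, G', hj, if_false]
        exact hasFDerivAt_const _ _)
    (by
      simp_rw [hsum]
      exact hcont.continuousOn.integrableOn_compact isCompact_Icc)
  simp_rw [hsum] at key
  rw [key]
  refine Finset.sum_eq_zero fun j _ => ?_
  by_cases hj : j = i
  · subst hj
    rw [sub_eq_zero]
    refine integral_congr_ae (Filter.Eventually.of_forall fun y => ?_)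
    simp only [G, if_true, hL]
    -- A point of the upper face is its counterpart on the lower face translated by one period.
    refine Eq.trans (congrArg u ?_) (hu.1 j _)
    ext k
    by_cases hk : k = j
    · subst hk; simp; ring
    · obtain ⟨k, rfl⟩ := Fin.exists_succAbove_eq hk
      simp
  · simp [G, hj]

/-- This is integration by parts against constants. It gives constants the weak gradient zero and,
applied to products, makes classical gradients weak gradients. -/
theorem IsTest.integral_gradient_eq_zero {χ : Space d → ℝ} (hχ : D.IsTest χ) :
    ∫ x, _root_.gradient χ x ∂(D.leb d) = 0 := by
  have hint : Integrable (_root_.gradient χ) (D.leb d) :=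
    hχ.1.1.gradient.integrable hχ.1.continuous_gradient hχ.hasCompactSupport_gradient
  refine ext_inner_left ℝ fun v => ?_
  rw [← integral_inner (𝕜 := ℝ) hint v, inner_zero_right]
  simp only [inner_gradient_right, conj_trivial]
  cases D with
  | line =>
    have hi : Integrable (fun x => fderiv ℝ χ x v) (volume : Measure (Space d)) := by
      have := hint.const_inner (𝕜 := ℝ) v
      simp only [inner_gradient_right, conj_trivial] at this
      exact this
    have h := integral_mul_fderiv_eq_neg_fderiv_mul_of_integrable
      (μ := (volume : Measure (Space d))) (f := fun _ => (1 : ℝ)) (g := χ) (v := v) (by simp) (by simpa using hi)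
      (by simpa using hχ.1.continuous.integrable_of_hasCompactSupport (hχ.2 rfl))
      (fun _ _ => by fun_prop) (fun x _ => hχ.1.differentiable x)
    simpa [leb] using h
  | torus =>
    have hb : ∀ i, ∫ x, fderiv ℝ χ x (EuclideanSpace.single i 1) ∂(torus.leb d) = 0 := by
      intro i
      cases d with
      | zero => exact i.elim0
      | succ n => exact setIntegral_fundamentalCube_fderiv_single hχ.1 i
    have hv : v = ∑ i, v i • EuclideanSpace.single i (1 : ℝ) := by
      have := (EuclideanSpace.basisFun (Fin d) ℝ).sum_repr v
      simpa using this.symm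
    rw [hv]
    simp only [map_sum, map_smul]
    rw [integral_finsetSum]
    · simp [integral_const_mul, hb]
    · intro i _
      have := hint.const_inner (𝕜 := ℝ) (EuclideanSpace.single i (1 : ℝ))
      simp only [inner_gradient_right, conj_trivial] at this
      exact this.smul (v i)

end Factor

/-! ### Gibbs measures -/

/-- A smooth potential with finite partition function. -/
structure IsPotential (D : Factor) (W : Space d → ℝ) : Prop where
  smooth : D.IsSmooth W
  integrable_exp : Integrable (fun x => Real.exp (-W x)) (D.leb d)

theorem MeasureTheory.MemLp.integrable_inner_two {α E : Type*} [MeasurableSpace α] {μ : Measure α}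
    [NormedAddCommGroup E] [InnerProductSpace ℝ E] {f g : α → E}
    (hf : MemLp f 2 μ) (hg : MemLp g 2 μ) : Integrable (fun x => (inner ℝ (f x) (g x) : ℝ)) μ :=
  memLp_one_iff_integrable.1 ((innerSL ℝ).memLp_of_bilin 1 hf hg)

theorem MeasureTheory.MemLp.integrable_mul_two {α : Type*} [MeasurableSpace α] {μ : Measure α}
    {f g : α → ℝ} (hf : MemLp f 2 μ) (hg : MemLp g 2 μ) : Integrable (fun x => f x * g x) μ :=
  hf.integrable_mul hg

theorem MeasureTheory.MemLp.bdd_smul {α E : Type*} [MeasurableSpace α] {μ : Measure α}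
    [NormedAddCommGroup E] [NormedSpace ℝ E] {a : α → ℝ} {g : α → E} {p : ENNReal}
    (hg : MemLp g p μ) (ha : AEStronglyMeasurable a μ) {C : ℝ} (hC : ∀ x, ‖a x‖ ≤ C) :
    MemLp (fun x => a x • g x) p μ :=
  hg.of_le_mul (c := C) (ha.smul hg.1) (Filter.Eventually.of_forall fun x => by
    rw [norm_smul]; gcongr; exact hC x)

theorem MeasureTheory.MemLp.smul_bdd {α E : Type*} [MeasurableSpace α] {μ : Measure α}
    [NormedAddCommGroup E] [NormedSpace ℝ E] {a : α → E} {g : α → ℝ} {p : ENNReal}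
    (hg : MemLp g p μ) (ha : AEStronglyMeasurable a μ) {C : ℝ} (hC : ∀ x, ‖a x‖ ≤ C) :
    MemLp (fun x => g x • a x) p μ :=
  hg.of_le_mul (c := C) (hg.1.smul ha) (Filter.Eventually.of_forall fun x => by
    rw [norm_smul, mul_comm]; gcongr; exact hC x)

namespace IsPotential

variable {D : Factor} {W : Space d → ℝ}

theorem isProbabilityMeasure (hW : IsPotential D W) : IsProbabilityMeasure (gibbs D W) :=
  isProbabilityMeasure_tilted hW.integrable_exp

theorem partitionFunction_pos (hW : IsPotential D W) : 0 < partitionFunction D W :=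
  integral_exp_pos hW.integrable_exp

theorem ae_eq_iff (hW : IsPotential D W) {β : Type*} {u v : Space d → β} :
    u =ᵐ[gibbs D W] v ↔ u =ᵐ[D.leb d] v :=
  ⟨fun h => (absolutelyContinuous_tilted hW.integrable_exp).ae_le h,
    fun h => (tilted_absolutelyContinuous _ _).ae_le h⟩

theorem integrable_iff (hW : IsPotential D W) {E : Type*} [NormedAddCommGroup E]
    [NormedSpace ℝ E] {u : Space d → E} :
    Integrable u (gibbs D W) ↔ Integrable (fun x => Real.exp (-W x) • u x) (D.leb d) :=
  integrable_tilted_iff hW.integrable_exp u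

theorem _root_.partitionFunction_mul_integral_gibbs (hW : IsPotential D W) (u : Space d → ℝ) :
    partitionFunction D W * ∫ x, u x ∂(gibbs D W) = ∫ x, u x * Real.exp (-W x) ∂(D.leb d) := by
  have h : ∫ x, u x ∂(gibbs D W) =
      (partitionFunction D W)⁻¹ * ∫ x, u x * Real.exp (-W x) ∂(D.leb d) := by
    rw [gibbs, integral_tilted, ← integral_const_mul]
    refine integral_congr_ae (Filter.Eventually.of_forall fun x => ?_)
    simp only [smul_eq_mul, partitionFunction]
    ring
  rw [h, mul_inv_cancel_left₀ hW.partitionFunction_pos.ne']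

/-- A test factor absorbs the density `e^{-W}`. -/
theorem integrable_smul_test (hW : IsPotential D W) {E : Type} [NormedAddCommGroup E]
    [NormedSpace ℝ E] {u : Space d → ℝ} (hu : MemLp u 2 (gibbs D W)) {θ : Space d → E}
    (hθ : D.IsFunction θ) (hc : Continuous θ) (hs : D = Factor.line → HasCompactSupport θ) :
    Integrable (fun x => u x • θ x) (D.leb d) := by
  have := hW.isProbabilityMeasure
  have h1 := hW.integrable_iff.1 (hu.integrable (by norm_num))
  have hWc := hW.smooth.continuous
  obtain ⟨C, hC⟩ := Factor.IsFunction.exists_bound (D := D)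
    (u := fun x => Real.exp (W x) • θ x)
    (hW.smooth.1.comp₂ hθ (fun a b => Real.exp a • b)) (by fun_prop) (fun h => (hs h).smul_left)
  have h2 := memLp_one_iff_integrable.1 ((memLp_one_iff_integrable.2 h1).smul_bdd
    (a := fun x => Real.exp (W x) • θ x)
    (Continuous.aestronglyMeasurable (by fun_prop)) hC)
  refine h2.congr (Filter.Eventually.of_forall fun x => ?_)
  simp only [smul_smul, smul_eq_mul, Real.exp_neg]
  congr 1
  field_simp

theorem integrable_test_smul (hW : IsPotential D W) {E : Type} [NormedAddCommGroup E]
    [NormedSpace ℝ E] {g : Space d → E} (hg : MemLp g 2 (gibbs D W)) {θ : Space d → ℝ}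
    (hθ : D.IsFunction θ) (hc : Continuous θ) (hs : D = Factor.line → HasCompactSupport θ) :
    Integrable (fun x => θ x • g x) (D.leb d) := by
  have := hW.isProbabilityMeasure
  have h1 := hW.integrable_iff.1 (hg.integrable (by norm_num))
  have hWc := hW.smooth.continuous
  obtain ⟨C, hC⟩ := Factor.IsFunction.exists_bound (D := D)
    (u := fun x => Real.exp (W x) * θ x)
    (hW.smooth.1.comp₂ hθ (fun a b => Real.exp a * b)) (by fun_prop) (fun h => (hs h).mul_left)
  have h2 := memLp_one_iff_integrable.1 ((memLp_one_iff_integrable.2 h1).bdd_smul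
    (a := fun x => Real.exp (W x) * θ x)
    (Continuous.aestronglyMeasurable (by fun_prop)) hC)
  refine h2.congr (Filter.Eventually.of_forall fun x => ?_)
  simp only [smul_smul, Real.exp_neg]
  congr 1
  field_simp

theorem add_bounded (hW : IsPotential D W) {b : Space d → ℝ} (hb : D.IsSmooth b) {C : ℝ}
    (hC : ∀ x, ‖b x‖ ≤ C) : IsPotential D (W + b) := by
  refine ⟨hW.smooth.add hb, ?_⟩
  have hbc := hb.continuous
  have h := memLp_one_iff_integrable.1 ((memLp_one_iff_integrable.2 hW.integrable_exp).bdd_smul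
    (a := fun x => Real.exp (-b x)) (C := Real.exp C)
    (Continuous.aestronglyMeasurable (by fun_prop)) (fun x => by
      rw [Real.norm_eq_abs, Real.abs_exp, Real.exp_le_exp]
      exact (neg_le_abs _).trans (hC x)))
  refine h.congr (Filter.Eventually.of_forall fun x => ?_)
  simp only [smul_eq_mul, Pi.add_apply, neg_add, Real.exp_add]
  ring

theorem gibbs_add (hW : IsPotential D W) (b : Space d → ℝ) :
    gibbs D (W + b) = (gibbs D W).tilted (fun x => -b x) := by
  unfold gibbs
  rw [tilted_tilted hW.integrable_exp]
  congr 1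
  ext x
  simp only [Pi.add_apply]
  ring

/-- The density of the perturbed measure with respect to the original one is `e^{-b} / ∫ e^{-b}`,
which is at most `e^C / ∫ e^{-b}`. -/
theorem memLp_add_bounded (hW : IsPotential D W) {b : Space d → ℝ} {C : ℝ}
    (hC : ∀ x, ‖b x‖ ≤ C) {E : Type*} [NormedAddCommGroup E] {u : Space d → E} {p : ENNReal}
    (hu : MemLp u p (gibbs D W)) : MemLp u p (gibbs D (W + b)) := by
  rw [hW.gibbs_add]
  refine hu.of_measure_le_smul
    (c := ENNReal.ofReal (Real.exp C / ∫ x, Real.exp (-b x) ∂(gibbs D W)))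
    ENNReal.ofReal_ne_top ?_
  rw [Measure.tilted, ← withDensity_const]
  refine withDensity_mono (Filter.Eventually.of_forall fun x => ?_)
  refine ENNReal.ofReal_le_ofReal ?_
  gcongr
  exact (neg_le_abs _).trans (hC x)

end IsPotential

/-! ### Weighted Sobolev functions -/

namespace MemH1

variable {D : Factor} {W : Space d → ℝ} {u : Space d → ℝ} {g : Space d → Space d}

theorem add_bounded (hW : IsPotential D W) {b : Space d → ℝ} {C : ℝ}
    (hC : ∀ x, ‖b x‖ ≤ C) (h : MemH1 D W u g) : MemH1 D (W + b) u g :=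
  ⟨h.1, h.2, hW.memLp_add_bounded hC h.3, hW.memLp_add_bounded hC h.4, h.5⟩

theorem of_add_bounded (hW : IsPotential D W) {b : Space d → ℝ} (hb : D.IsSmooth b) {C : ℝ}
    (hC : ∀ x, ‖b x‖ ≤ C) (h : MemH1 D (W + b) u g) : MemH1 D W u g := by
  have h2 := h.add_bounded (hW.add_bounded hb hC) (b := fun x => -b x) (C := C)
    (fun x => by rw [norm_neg]; exact hC x)
  have e : W + b + (fun x => -b x) = W := by ext x; simp
  rwa [e] at h2

theorem sub_const (hW : IsPotential D W) (h : MemH1 D W u g) (c : ℝ) :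
    MemH1 D W (fun x => u x - c) g := by
  have := hW.isProbabilityMeasure
  refine ⟨h.1.comp (· - c), h.2, h.3.sub (memLp_const c), h.4, fun χ hχ => ?_⟩
  rw [← h.5 χ hχ]
  have h1 : Integrable (fun x => u x • gradient χ x) (D.leb d) :=
    hW.integrable_smul_test h.3 hχ.1.1.gradient hχ.1.continuous_gradient
      hχ.hasCompactSupport_gradient
  have h2 : Integrable (fun x => c • gradient χ x) (D.leb d) :=
    (hχ.1.1.gradient.integrable hχ.1.continuous_gradient hχ.hasCompactSupport_gradient).smul c
  simp_rw [sub_smul]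
  rw [integral_sub h1 h2, integral_smul, hχ.integral_gradient_eq_zero]
  simp

theorem memH1Zero_sub_integral (hW : IsPotential D W) (h : MemH1 D W u g) :
    MemH1Zero D W (fun x => u x - ∫ y, u y ∂(gibbs D W)) g := by
  have := hW.isProbabilityMeasure
  refine ⟨h.sub_const hW _, ?_⟩
  rw [integral_sub (h.3.integrable (by norm_num)) (integrable_const _)]
  simp

/-- Product rule. -/
theorem smooth_mul (hW : IsPotential D W) (h : MemH1 D W u g) {X : Space d → ℝ}
    (hX : D.IsSmooth X) {C C' : ℝ} (hC : ∀ x, ‖X x‖ ≤ C) (hC' : ∀ x, ‖gradient X x‖ ≤ C') :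
    MemH1 D W (fun x => X x * u x) (fun x => X x • g x + u x • gradient X x) := by
  refine ⟨hX.1.comp₂ h.1 (· * ·),
    (hX.1.comp₂ h.2 (· • ·)).comp₂ (h.1.comp₂ hX.1.gradient (· • ·)) (· + ·),
    h.3.bdd_smul hX.continuous.aestronglyMeasurable hC,
    (h.4.bdd_smul hX.continuous.aestronglyMeasurable hC).add
      (h.3.smul_bdd hX.continuous_gradient.aestronglyMeasurable hC'), fun χ hχ => ?_⟩
  have hXχ := hχ.smooth_mul hX
  have h5 := h.5 _ hXχ
  have i1 : Integrable (fun x => u x • (X x • gradient χ x)) (D.leb d) :=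
    hW.integrable_smul_test h.3 (hX.1.comp₂ hχ.1.1.gradient (· • ·))
      (hX.continuous.smul hχ.1.continuous_gradient)
      (fun e => HasCompactSupport.smul_left (f := X) (f' := gradient χ)
        (hχ.hasCompactSupport_gradient e))
  have i2 : Integrable (fun x => u x • (χ x • gradient X x)) (D.leb d) :=
    hW.integrable_smul_test h.3 (hχ.1.1.comp₂ hX.1.gradient (· • ·))
      (hχ.1.continuous.smul hX.continuous_gradient)
      (fun e => HasCompactSupport.smul_right (f := χ) (f' := gradient X) (hχ.2 e))
  have i3 : Integrable (fun x => (X x * χ x) • g x) (D.leb d) :=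
    hW.integrable_test_smul h.4 hXχ.1.1 hXχ.1.continuous hXχ.2
  have e1 : ∫ x, (X x * u x) • gradient χ x ∂(D.leb d) =
      ∫ x, u x • (X x • gradient χ x) ∂(D.leb d) := by
    congr 1; ext1 x; rw [smul_smul, mul_comm]
  have e2 : ∫ x, χ x • (X x • g x + u x • gradient X x) ∂(D.leb d) =
      ∫ x, (X x * χ x) • g x ∂(D.leb d) + ∫ x, u x • (χ x • gradient X x) ∂(D.leb d) := by
    rw [← integral_add i3 i2]
    congr 1; ext1 x
    rw [smul_add, smul_smul, smul_smul, smul_smul, mul_comm (χ x), mul_comm (χ x)]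
  rw [e1, e2]
  simp_rw [Factor.gradient_mul hX.differentiable hχ.1.differentiable, smul_add] at h5
  rw [integral_add i1 i2] at h5
  rw [neg_add, ← h5]
  abel

theorem of_isSmooth (hu : D.IsSmooth u) (hu2 : MemLp u 2 (gibbs D W))
    (hg2 : MemLp (gradient u) 2 (gibbs D W)) : MemH1 D W u (gradient u) := by
  refine ⟨hu.1, hu.1.gradient, hu2, hg2, fun χ hχ => ?_⟩
  have h0 := (hχ.smooth_mul hu).integral_gradient_eq_zero
  simp_rw [Factor.gradient_mul hu.differentiable hχ.1.differentiable] at h0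
  have i1 : Integrable (fun x => u x • gradient χ x) (D.leb d) :=
    (hu.1.comp₂ hχ.1.1.gradient (· • ·)).integrable
      (hu.continuous.smul hχ.1.continuous_gradient)
      (fun e => HasCompactSupport.smul_left (f := u) (f' := gradient χ)
        (hχ.hasCompactSupport_gradient e))
  have i2 : Integrable (fun x => χ x • gradient u x) (D.leb d) :=
    (hχ.1.1.comp₂ hu.1.gradient (· • ·)).integrable
      (hχ.1.continuous.smul hu.continuous_gradient)
      (fun e => HasCompactSupport.smul_right (f := χ) (f' := gradient u) (hχ.2 e))
  rw [integral_add i1 i2] at h0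
  exact eq_neg_of_add_eq_zero_left h0

end MemH1

/-! ### The Hilbert space `H¹(μ_W) ∩ L²₀(μ_W)` -/

/-- Pairs (function, vector field) of class `L²(μ_W)`. -/
abbrev L2Pair (D : Factor) (W : Space d → ℝ) : Type :=
  WithLp 2 (Lp ℝ 2 (gibbs D W) × Lp (Space d) 2 (gibbs D W))

/-- The pair of classes `p` is represented by the functions `u` and `g`. -/
def Represents {D : Factor} {W : Space d → ℝ} (u : Space d → ℝ) (g : Space d → Space d)
    (p : L2Pair D W) : Prop :=
  p.fst =ᵐ[gibbs D W] u ∧ p.snd =ᵐ[gibbs D W] g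

theorem Represents.inner_eq {D : Factor} {W : Space d → ℝ} {u v : Space d → ℝ}
    {g k : Space d → Space d} {p q : L2Pair D W} (hp : Represents u g p) (hq : Represents v k q) :
    (inner ℝ p q : ℝ) = ∫ x, u x * v x ∂(gibbs D W) + ∫ x, inner ℝ (g x) (k x) ∂(gibbs D W) := by
  rw [WithLp.prod_inner_apply, L2.inner_def, L2.inner_def]
  congr 1
  · refine integral_congr_ae ?_
    filter_upwards [hp.1, hq.1] with x h1 h2
    have e1 : (p.ofLp.1 : Space d → ℝ) x = u x := h1
    have e2 : (q.ofLp.1 : Space d → ℝ) x = v x := h2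
    rw [e1, e2]
    simp [mul_comm]
  · refine integral_congr_ae ?_
    filter_upwards [hp.2, hq.2] with x h1 h2
    have e1 : (p.ofLp.2 : Space d → Space d) x = g x := h1
    have e2 : (q.ofLp.2 : Space d → Space d) x = k x := h2
    rw [e1, e2]

theorem represents_toLp {D : Factor} {W : Space d → ℝ} {u : Space d → ℝ}
    {g : Space d → Space d} (hu : MemLp u 2 (gibbs D W)) (hg : MemLp g 2 (gibbs D W)) :
    Represents u g (WithLp.toLp 2 (hu.toLp u, hg.toLp g) : L2Pair D W) :=
  ⟨hu.coeFn_toLp, hg.coeFn_toLp⟩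

/-- The pairs to which the elements of `H¹(μ_W) ∩ L²₀(μ_W)` are orthogonal. -/
def annihilators (D : Factor) (W : Space d → ℝ) : Set (L2Pair D W) :=
  {p | Represents (fun _ => 1) (fun _ => 0) p ∨ ∃ (χ : Space d → ℝ) (v : Space d), D.IsTest χ ∧
    Represents (fun x => Real.exp (W x) * inner ℝ v (gradient χ x))
      (fun x => (Real.exp (W x) * χ x) • v) p}

/-- `H¹(μ_W) ∩ L²₀(μ_W)` as a closed subspace of `L²(μ_W) × L²(μ_W)^d`. -/
def h1Zero (D : Factor) (W : Space d → ℝ) : Submodule ℝ (L2Pair D W) :=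
  (Submodule.span ℝ (annihilators D W))ᗮ

instance (D : Factor) (W : Space d → ℝ) : CompleteSpace (h1Zero D W) :=
  inferInstanceAs (CompleteSpace ↥(Submodule.span ℝ (annihilators D W))ᗮ)

theorem mem_h1Zero_iff {D : Factor} {W : Space d → ℝ} (p : L2Pair D W) :
    p ∈ h1Zero D W ↔ ∀ q ∈ annihilators D W, (inner ℝ q p : ℝ) = 0 := by
  constructor
  · exact fun h q hq => (Submodule.mem_orthogonal _ _).1 h q (Submodule.subset_span hq)
  · intro h
    have hle : Submodule.span ℝ (annihilators D W) ≤ (ℝ ∙ p)ᗮ :=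
      Submodule.span_le.2 fun q hq =>
        Submodule.mem_orthogonal_singleton_iff_inner_left.2 (h q hq)
    exact (Submodule.mem_orthogonal _ _).2 fun q hq =>
      Submodule.mem_orthogonal_singleton_iff_inner_left.1 (hle hq)

/-- The factor `e^W` in an annihilator cancels the density of `μ_W`. Orthogonality to it is
therefore the Lebesgue weak gradient identity for `χ`, read in the direction `v`. -/
theorem inner_annihilator_eq {D : Factor} {W : Space d → ℝ} (hW : IsPotential D W)
    {u : Space d → ℝ} {g : Space d → Space d} (hu : MemLp u 2 (gibbs D W))
    (hg : MemLp g 2 (gibbs D W)) {χ : Space d → ℝ} (hχ : D.IsTest χ) (v : Space d) :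
    partitionFunction D W *
      (∫ x, Real.exp (W x) * inner ℝ v (gradient χ x) * u x ∂(gibbs D W) +
        ∫ x, inner ℝ ((Real.exp (W x) * χ x) • v) (g x) ∂(gibbs D W)) =
    inner ℝ v (∫ x, u x • gradient χ x ∂(D.leb d) + ∫ x, χ x • g x ∂(D.leb d)) := by
  have i1 := hW.integrable_smul_test hu hχ.1.1.gradient hχ.1.continuous_gradient
    hχ.hasCompactSupport_gradient
  have i2 := hW.integrable_test_smul hg hχ.1.1 hχ.1.continuous hχ.2
  rw [mul_add, partitionFunction_mul_integral_gibbs hW, partitionFunction_mul_integral_gibbs hW,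
    inner_add_right, ← integral_inner (𝕜 := ℝ) i1, ← integral_inner (𝕜 := ℝ) i2]
  congr 1
  · refine integral_congr_ae (Filter.Eventually.of_forall fun x => ?_)
    simp only [inner_smul_right, Real.exp_neg]
    field_simp
  · refine integral_congr_ae (Filter.Eventually.of_forall fun x => ?_)
    simp only [inner_smul_right, inner_smul_left, Real.exp_neg, conj_trivial]
    field_simp

/-- The factor `e^W` may be unbounded, but its products with `χ` and `∇χ` are bounded, by compact
support or by periodicity, and so lie in `L²` of a probability measure. -/
theorem exists_annihilator {D : Factor} {W : Space d → ℝ} (hW : IsPotential D W)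
    {χ : Space d → ℝ} (hχ : D.IsTest χ) (v : Space d) :
    ∃ p ∈ annihilators D W, Represents (fun x => Real.exp (W x) * inner ℝ v (gradient χ x))
      (fun x => (Real.exp (W x) * χ x) • v) p := by
  have := hW.isProbabilityMeasure
  have hWc := hW.smooth.continuous
  have hgc := hχ.1.continuous_gradient
  have hχc := hχ.1.continuous
  obtain ⟨C, hC⟩ := Factor.IsFunction.exists_bound (D := D)
    (u := fun x => Real.exp (W x) * inner ℝ v (gradient χ x))
    (hW.smooth.1.comp₂ hχ.1.1.gradient (fun a b => Real.exp a * inner ℝ v b)) (by fun_prop)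
    (fun e => HasCompactSupport.mul_left (f := fun x => Real.exp (W x))
      (f' := fun x => inner ℝ v (gradient χ x))
      ((hχ.hasCompactSupport_gradient e).comp_left (g := fun y => inner ℝ v y) (by simp)))
  obtain ⟨C', hC'⟩ := Factor.IsFunction.exists_bound (D := D)
    (u := fun x => (Real.exp (W x) * χ x) • v)
    (hW.smooth.1.comp₂ hχ.1.1 (fun a b => (Real.exp a * b) • v)) (by fun_prop)
    (fun e => HasCompactSupport.smul_right (f := fun x => Real.exp (W x) * χ x)
      (f' := fun _ => v)
      (HasCompactSupport.mul_left (f := fun x => Real.exp (W x)) (f' := χ) (hχ.2 e)))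
  have m1 : MemLp (fun x => Real.exp (W x) * inner ℝ v (gradient χ x)) 2 (gibbs D W) :=
    MemLp.of_bound (Continuous.aestronglyMeasurable (by fun_prop)) C
      (Filter.Eventually.of_forall hC)
  have m2 : MemLp (fun x => (Real.exp (W x) * χ x) • v) 2 (gibbs D W) :=
    MemLp.of_bound (Continuous.aestronglyMeasurable (by fun_prop)) C'
      (Filter.Eventually.of_forall hC')
  exact ⟨_, Or.inr ⟨χ, v, hχ, represents_toLp m1 m2⟩, represents_toLp m1 m2⟩

theorem MemH1Zero.exists_represents {D : Factor} {W : Space d → ℝ} (hW : IsPotential D W)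
    {u : Space d → ℝ} {g : Space d → Space d} (h : MemH1Zero D W u g) :
    ∃ p : h1Zero D W, Represents u g p.1 := by
  have hr := represents_toLp h.1.3 h.1.4
  refine ⟨⟨_, (mem_h1Zero_iff _).2 fun q hq => ?_⟩, hr⟩
  rcases hq with hq | ⟨χ, v, hχ, hq⟩
  · rw [hq.inner_eq hr]
    simp [h.2]
  · rw [hq.inner_eq hr]
    have h1 := inner_annihilator_eq hW h.1.3 h.1.4 hχ v
    rw [h.1.5 χ hχ, neg_add_cancel, inner_zero_right] at h1
    exact (mul_eq_zero.1 h1).resolve_left hW.partitionFunction_pos.ne'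

theorem memH1Zero_of_represents {D : Factor} {W : Space d → ℝ} (hW : IsPotential D W)
    {u : Space d → ℝ} {g : Space d → Space d} (hu : D.IsFunction u) (hg : D.IsFunction g)
    (p : h1Zero D W) (hr : Represents u g p.1) : MemH1Zero D W u g := by
  have := hW.isProbabilityMeasure
  have mu : MemLp u 2 (gibbs D W) := (memLp_congr_ae hr.1).1 (Lp.memLp _)
  have mg : MemLp g 2 (gibbs D W) := (memLp_congr_ae hr.2).1 (Lp.memLp _)
  have hp := (mem_h1Zero_iff _).1 p.2
  refine ⟨⟨hu, hg, mu, mg, fun χ hχ => ?_⟩, ?_⟩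
  · rw [eq_neg_iff_add_eq_zero]
    refine ext_inner_left ℝ fun v => ?_
    obtain ⟨q, hq, hqr⟩ := exists_annihilator hW hχ v
    have h1 := hp q hq
    rw [hqr.inner_eq hr] at h1
    rw [← inner_annihilator_eq hW mu mg hχ v, h1, mul_zero, inner_zero_right]
  · have hr1 := represents_toLp (D := D) (W := W) (memLp_const (1 : ℝ)) (memLp_const (0 : Space d))
    have h1 := hp _ (Or.inl hr1)
    rw [hr1.inner_eq hr] at h1
    simpa using h1

theorem h1Zero_exists_memH1Zero {D : Factor} {W : Space d → ℝ} (hW : IsPotential D W)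
    (p : h1Zero D W) : ∃ (u : Space d → ℝ) (g : Space d → Space d),
      MemH1Zero D W u g ∧ Represents u g p.1 := by
  obtain ⟨u, hu, hue⟩ := D.exists_isFunction_ae_eq (p.1.fst : Space d → ℝ)
  obtain ⟨g, hg, hge⟩ := D.exists_isFunction_ae_eq (p.1.snd : Space d → Space d)
  have hr : Represents u g p.1 := ⟨(hW.ae_eq_iff.2 hue).symm, (hW.ae_eq_iff.2 hge).symm⟩
  exact ⟨u, g, memH1Zero_of_represents hW hu hg p hr, hr⟩

/-- The gradient on `H¹(μ_W) ∩ L²₀(μ_W)`. -/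
def gradL (D : Factor) (W : Space d → ℝ) : h1Zero D W →L[ℝ] Lp (Space d) 2 (gibbs D W) :=
  (WithLp.sndL 2 ℝ _ _).comp (h1Zero D W).subtypeL

/-- The inclusion of `H¹(μ_W) ∩ L²₀(μ_W)` in `L²(μ_W)`. -/
def valueL (D : Factor) (W : Space d → ℝ) : h1Zero D W →L[ℝ] Lp ℝ 2 (gibbs D W) :=
  (WithLp.fstL 2 ℝ _ _).comp (h1Zero D W).subtypeL

/-- The source term `h ∈ L²(μ_W)` as a functional on `H¹(μ_W) ∩ L²₀(μ_W)`. -/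
theorem exists_source_vector {D : Factor} {W : Space d → ℝ} {h : Space d → ℝ}
    (hh : MemLp h 2 (gibbs D W)) :
    ∃ r : h1Zero D W, ∀ (q : h1Zero D W) (v : Space d → ℝ) (k : Space d → Space d),
      Represents v k q.1 → (inner ℝ r q : ℝ) = ∫ x, h x * v x ∂(gibbs D W) := by
  refine ⟨ContinuousLinearMap.adjoint (valueL D W) (hh.toLp h), fun q v k hq => ?_⟩
  rw [ContinuousLinearMap.adjoint_inner_left, L2.inner_def]
  refine integral_congr_ae ?_
  filter_upwards [hh.coeFn_toLp, hq.1] with x e1 e2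
  have e2' : (valueL D W q : Space d → ℝ) x = v x := e2
  rw [e1, e2']
  simp [mul_comm]

/-! ### Weighted forms -/

section Forms

variable (D : Factor) (W : Space d → ℝ) [IsProbabilityMeasure (gibbs D W)]

/-- Multiplication of a vector field by a bounded continuous function. -/
def mulField : (Space d →ᵇ ℝ) →L[ℝ] Lp (Space d) 2 (gibbs D W) →L[ℝ] Lp (Space d) 2 (gibbs D W) :=
  ((ContinuousLinearMap.lsmul ℝ ℝ).holderL (gibbs D W) ⊤ 2 2).comp
    (BoundedContinuousFunction.toLp ⊤ (gibbs D W) ℝ)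

/-- The operator of the form `(u, v) ↦ ∫ a ∇u · ∇v dμ_W`. -/
def gradForm : (Space d →ᵇ ℝ) →L[ℝ] h1Zero D W →L[ℝ] h1Zero D W :=
  ((ContinuousLinearMap.postcomp _ (ContinuousLinearMap.adjoint (gradL D W))).comp
    (ContinuousLinearMap.precomp _ (gradL D W))).comp (mulField D W)

/-- The integral against `μ_W`. -/
def gibbsMean : (Space d →ᵇ ℝ) →L[ℝ] ℝ :=
  LinearMap.mkContinuous
    { toFun := fun a => ∫ x, a x ∂(gibbs D W)
      map_add' := fun a b => integral_add (a.integrable _) (b.integrable _)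
      map_smul' := fun c a => integral_const_mul c _ } 1
    (fun a => by simpa using BoundedContinuousFunction.norm_integral_le_norm (gibbs D W) a)

variable {D W}

@[simp]
theorem gibbsMean_apply (a : Space d →ᵇ ℝ) : gibbsMean D W a = ∫ x, a x ∂(gibbs D W) := rfl

theorem mulField_ae_eq (a : Space d →ᵇ ℝ) (g : Lp (Space d) 2 (gibbs D W)) :
    mulField D W a g =ᵐ[gibbs D W] fun x => a x • g x := by
  have h1 := (ContinuousLinearMap.lsmul ℝ ℝ).coeFn_holder (r := 2)
    (BoundedContinuousFunction.toLp ⊤ (gibbs D W) ℝ a) g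
  have h2 := BoundedContinuousFunction.coeFn_toLp (p := ⊤) (gibbs D W) (𝕜 := ℝ) a
  filter_upwards [h1, h2] with x e1 e2
  rw [e2] at e1
  exact e1

theorem inner_gradForm {u v : Space d → ℝ} {g k : Space d → Space d} {p q : h1Zero D W}
    (hp : Represents u g p.1) (hq : Represents v k q.1) (a : Space d →ᵇ ℝ) :
    inner ℝ (gradForm D W a p) q = ∫ x, a x * inner ℝ (g x) (k x) ∂(gibbs D W) := by
  have h : (inner ℝ (gradForm D W a p) q : ℝ) =
      inner ℝ (mulField D W a (gradL D W p)) (gradL D W q) :=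
    ContinuousLinearMap.adjoint_inner_left (gradL D W) q (mulField D W a (gradL D W p))
  rw [h, L2.inner_def]
  refine integral_congr_ae ?_
  filter_upwards [mulField_ae_eq a (gradL D W p), hp.2, hq.2] with x e1 e2 e3
  have e2' : (gradL D W p : Space d → Space d) x = g x := e2
  have e3' : (gradL D W q : Space d → Space d) x = k x := e3
  rw [e1, e2', e3', inner_smul_left]
  simp

theorem gradForm_symm (hW : IsPotential D W) (a : Space d →ᵇ ℝ) (p q : h1Zero D W) :
    (inner ℝ (gradForm D W a p) q : ℝ) = inner ℝ p (gradForm D W a q) := by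
  obtain ⟨u, g, -, hp⟩ := h1Zero_exists_memH1Zero hW p
  obtain ⟨v, k, -, hq⟩ := h1Zero_exists_memH1Zero hW q
  rw [real_inner_comm (gradForm D W a q) p, inner_gradForm hp hq, inner_gradForm hq hp]
  simp_rw [real_inner_comm (g _) (k _)]

/-- Lax–Milgram: the form controls `c ‖∇u‖²`, and the Poincaré inequality upgrades this to the full
`H¹` norm. -/
theorem isUnit_gradForm (hW : IsPotential D W) (hP : Poincare D W) {a : Space d →ᵇ ℝ} {c : ℝ}
    (hc : 0 < c) (ha : ∀ x, c ≤ a x) : IsUnit (gradForm D W a) := by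
  obtain ⟨R, hR, hP⟩ := hP
  -- The Poincaré inequality gives `‖p‖² = ‖u‖² + ‖∇u‖² ≤ (1 / R + 1) ‖∇u‖²`, whence this coercivity
  -- constant.
  have hc' : 0 < c / (1 / R + 1) := by positivity
  refine ContinuousLinearMap.isUnit_of_forall_le_norm_inner_map _
    (c := ⟨c / (1 / R + 1), hc'.le⟩) hc' fun p => ?_
  obtain ⟨u, g, h, hr⟩ := h1Zero_exists_memH1Zero hW p
  have hn : ‖p‖ ^ 2 = ∫ x, u x ^ 2 ∂(gibbs D W) + ∫ x, ‖g x‖ ^ 2 ∂(gibbs D W) := by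
    rw [← real_inner_self_eq_norm_sq, Submodule.coe_inner, hr.inner_eq hr]
    simp_rw [real_inner_self_eq_norm_sq, sq]
  have hPu := hP u g h
  have hi : Integrable (fun x => ‖g x‖ ^ 2) (gibbs D W) := by
    have := h.1.4.integrable_inner_two h.1.4
    simpa only [real_inner_self_eq_norm_sq] using this
  have hai : Integrable (fun x => a x * ‖g x‖ ^ 2) (gibbs D W) := by
    have := (h.1.4.bdd_smul a.continuous.aestronglyMeasurable
      a.norm_coe_le_norm).integrable_inner_two h.1.4
    simpa only [inner_smul_left, real_inner_self_eq_norm_sq, conj_trivial] using this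
  have hle : c * ∫ x, ‖g x‖ ^ 2 ∂(gibbs D W) ≤ inner ℝ (gradForm D W a p) p := by
    rw [inner_gradForm hr hr, ← integral_const_mul]
    simp_rw [real_inner_self_eq_norm_sq]
    exact integral_mono (hi.const_mul c) hai fun x => by
      have := ha x
      dsimp only
      gcongr
  refine le_trans ?_ (le_abs_self _)
  refine le_trans ?_ hle
  change ‖p‖ ^ 2 * (c / (1 / R + 1)) ≤ _
  rw [hn, mul_div_assoc', div_le_iff₀ (by positivity)]
  nlinarith

theorem isWeakSolution_iff (hW : IsPotential D W) {h : Space d → ℝ} {r : h1Zero D W}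
    (hr : ∀ (q : h1Zero D W) (v : Space d → ℝ) (k : Space d → Space d), MemH1Zero D W v k →
      Represents v k q.1 → (inner ℝ r q : ℝ) = ∫ x, h x * v x ∂(gibbs D W))
    {u : Space d → ℝ} {g : Space d → Space d} (hu : MemH1Zero D W u g) {p : h1Zero D W}
    (hp : Represents u g p.1) :
    IsWeakSolution D W h u g ↔ gradForm D W 1 p = r := by
  constructor
  · intro hs
    refine ext_inner_right ℝ fun q => ?_
    obtain ⟨v, k, hv, hq⟩ := h1Zero_exists_memH1Zero hW q
    rw [inner_gradForm hp hq, hr q v k hv hq, ← hs.2 v k hv]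
    simp
  · intro he
    refine ⟨hu, fun v k hv => ?_⟩
    obtain ⟨q, hq⟩ := hv.exists_represents hW
    rw [← hr q v k hv hq, ← he, inner_gradForm hp hq]
    simp

/-- Existence is surjectivity and uniqueness is injectivity of the operator with weight `1`. The
source is tested only on Sobolev pairs, because for the perturbed equation the representing vector
`A_X φ_U` comes from an integration by parts. -/
theorem wellPosed_of_source_vector (hW : IsPotential D W) (hP : Poincare D W) {h : Space d → ℝ}
    {r : h1Zero D W}
    (hr : ∀ (q : h1Zero D W) (v : Space d → ℝ) (k : Space d → Space d), MemH1Zero D W v k →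
      Represents v k q.1 → (inner ℝ r q : ℝ) = ∫ x, h x * v x ∂(gibbs D W)) :
    WellPosed D W h := by
  have hu : IsUnit (gradForm D W 1) := isUnit_gradForm hW hP one_pos fun x => le_rfl
  have hbij := ContinuousLinearMap.isUnit_iff_bijective.1 hu
  constructor
  · obtain ⟨p, hp⟩ := hbij.2 r
    obtain ⟨u, g, hug, hrep⟩ := h1Zero_exists_memH1Zero hW p
    exact ⟨u, g, (isWeakSolution_iff hW hr hug hrep).2 hp⟩
  · intro u u' g g' hs hs'
    obtain ⟨p, hp⟩ := hs.1.exists_represents hW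
    obtain ⟨p', hp'⟩ := hs'.1.exists_represents hW
    have e := hbij.1 (((isWeakSolution_iff hW hr hs.1 hp).1 hs).trans
      ((isWeakSolution_iff hW hr hs'.1 hp').1 hs').symm)
    subst e
    exact ⟨hW.ae_eq_iff.1 (hp.1.symm.trans hp'.1), hW.ae_eq_iff.1 (hp.2.symm.trans hp'.2)⟩

attribute [irreducible] gradForm gibbsMean

end Forms

/-! ### The asymptotic variance along bounded perturbations -/

/-- Evaluation at a point is a continuous ring homomorphism, so it commutes with the exponential
series. -/
theorem BoundedContinuousFunction.exp_apply {α : Type*} [TopologicalSpace α] (a : α →ᵇ ℝ)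
    (x : α) : NormedSpace.exp a x = Real.exp (a x) := by
  let ev : (α →ᵇ ℝ) →+* ℝ :=
    { toFun := fun a => a x
      map_one' := rfl
      map_mul' := fun _ _ => rfl
      map_zero' := rfl
      map_add' := fun _ _ => rfl }
  have h := NormedSpace.map_exp_of_mem_ball (𝕂 := ℝ) ev
    (continuous_eval_const (F := α →ᵇ ℝ) x) a
    ((NormedSpace.expSeries_radius_eq_top ℝ (α →ᵇ ℝ)).symm ▸ edist_lt_top _ _)
  rw [Real.exp_eq_exp_ℝ]
  exact h

theorem BoundedContinuousFunction.exp_lower_bound {α : Type*} [TopologicalSpace α] (a : α →ᵇ ℝ)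
    (x : α) : Real.exp (-‖a‖) ≤ NormedSpace.exp a x := by
  rw [BoundedContinuousFunction.exp_apply, Real.exp_le_exp]
  exact (abs_le.1 (a.norm_coe_le_norm x)).1

namespace Factor.IsTest

variable {D : Factor} {χ : Space d → ℝ}

/-- A test function as a bounded continuous function. -/
def toBCF (hχ : D.IsTest χ) : Space d →ᵇ ℝ :=
  BoundedContinuousFunction.ofNormedAddCommGroup χ hχ.1.continuous hχ.exists_bound.choose
    hχ.exists_bound.choose_spec

@[simp]
theorem coe_toBCF (hχ : D.IsTest χ) : ⇑hχ.toBCF = χ := rfl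

end Factor.IsTest

/-! ### The Poisson source and its perturbations as functionals -/

section Source

variable {D : Factor} {V f U : Space d → ℝ}

theorem IsTargetPair.isPotential (hVf : IsTargetPair D V f) : IsPotential D V :=
  ⟨hVf.1, hVf.2⟩

theorem IsAdmissible.isPotential (hVf : IsTargetPair D V f) (hU : IsAdmissible D V f U) :
    IsPotential D (V + U) := ⟨hVf.1.add hU.1, hU.2⟩

/-- The right-hand side no longer contains `U`, so the same source functional serves all biasing
potentials. -/
theorem mul_integral_poissonSource_mul (hW : IsPotential D (V + U)) (χ : Space d → ℝ) :
    partitionFunction D (V + U) * ∫ x, poissonSource D V f U x * χ x ∂(gibbs D (V + U)) =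
      ∫ x, centredObservable D V f x * χ x * Real.exp (-V x) ∂(D.leb d) := by
  rw [partitionFunction_mul_integral_gibbs hW]
  refine integral_congr_ae (Filter.Eventually.of_forall fun x => ?_)
  simp only [poissonSource, Pi.add_apply, neg_add, Real.exp_add, Real.exp_neg]
  field_simp

theorem integrable_centredObservable (hVf : IsTargetPair D V f) :
    Integrable (fun x => centredObservable D V f x * Real.exp (-V x)) (D.leb d) := by
  have hV := hVf.isPotential
  have := hV.isProbabilityMeasure
  have h := hV.integrable_iff.1 (hVf.4.sub (integrable_const (∫ y, f y ∂(gibbs D V))))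
  refine h.congr (Filter.Eventually.of_forall fun x => ?_)
  simp [centredObservable, mul_comm]

theorem integral_centredObservable (hVf : IsTargetPair D V f) :
    ∫ x, centredObservable D V f x * Real.exp (-V x) ∂(D.leb d) = 0 := by
  have hV := hVf.isPotential
  have := hV.isProbabilityMeasure
  rw [← partitionFunction_mul_integral_gibbs hV]
  unfold centredObservable
  rw [integral_sub hVf.4 (integrable_const _)]
  simp

/-- Since `f - I` has mean zero, test functions may be recentred freely. This permits passing
between the zero-mean conditions of different measures `μ_U`. -/
theorem integral_centredObservable_sub_const (hVf : IsTargetPair D V f) {χ : Space d → ℝ}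
    (hχ : Integrable (fun x => centredObservable D V f x * χ x * Real.exp (-V x)) (D.leb d))
    (c : ℝ) :
    ∫ x, centredObservable D V f x * (χ x - c) * Real.exp (-V x) ∂(D.leb d) =
      ∫ x, centredObservable D V f x * χ x * Real.exp (-V x) ∂(D.leb d) := by
  have e : ∀ x, centredObservable D V f x * (χ x - c) * Real.exp (-V x) =
      centredObservable D V f x * χ x * Real.exp (-V x) -
        c * (centredObservable D V f x * Real.exp (-V x)) := fun x => by ring
  simp_rw [e]
  rw [integral_sub hχ ((integrable_centredObservable hVf).const_mul c), integral_const_mul,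
    integral_centredObservable hVf, mul_zero, sub_zero]

theorem IsAdmissible.integrable_centredObservable_mul (hVf : IsTargetPair D V f)
    (hU : IsAdmissible D V f U) {χ : Space d → ℝ} (hχ : MemLp χ 2 (gibbs D (V + U))) :
    Integrable (fun x => centredObservable D V f x * χ x * Real.exp (-V x)) (D.leb d) := by
  have h := (hU.isPotential hVf).integrable_iff.1 (hU.4.integrable_mul_two hχ)
  refine h.congr (Filter.Eventually.of_forall fun x => ?_)
  simp only [poissonSource, Pi.add_apply, neg_add, Real.exp_add, Real.exp_neg, smul_eq_mul]
  field_simp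

theorem mul_integral_gibbs_add (hW : IsPotential D (V + U)) {b : Space d →ᵇ ℝ}
    (hb : D.IsSmooth b) (F : Space d → ℝ) :
    partitionFunction D (V + (U + ⇑b)) * ∫ x, F x ∂(gibbs D (V + (U + ⇑b))) =
      partitionFunction D (V + U) *
        ∫ x, NormedSpace.exp (-b) x * F x ∂(gibbs D (V + U)) := by
  have hW' : IsPotential D (V + (U + ⇑b)) := by
    rw [← add_assoc]; exact hW.add_bounded hb b.norm_coe_le_norm
  rw [partitionFunction_mul_integral_gibbs hW, partitionFunction_mul_integral_gibbs hW']
  refine integral_congr_ae (Filter.Eventually.of_forall fun x => ?_)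
  simp only [BoundedContinuousFunction.exp_apply, Pi.add_apply, neg_add, Real.exp_add,
    BoundedContinuousFunction.coe_neg, Pi.neg_apply]
  ring

theorem integral_perturbedSource_mul (hVf : IsTargetPair D V f) (hU : IsAdmissible D V f U)
    {φ : Space d → ℝ} {g : Space d → Space d} (hφ : IsPoissonSolution D V f U φ g)
    {X : Space d → ℝ} (hX : D.IsSmooth X) {C C' : ℝ} (hC : ∀ x, ‖X x‖ ≤ C)
    (hC' : ∀ x, ‖gradient X x‖ ≤ C') {v : Space d → ℝ} {k : Space d → Space d}
    (hv : MemH1 D (V + U) v k) :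
    ∫ x, perturbedSource D V f U g X x * v x ∂(gibbs D (V + U)) =
      ∫ x, X x * inner ℝ (g x) (k x) ∂(gibbs D (V + U)) := by
  have hW := hU.isPotential hVf
  have hXv := hv.smooth_mul hW hX hC hC'
  -- The equation of `φ` is tested against `X v`, centred to be admissible. The product rule then
  -- splits the left side into the desired form and the term `∇X · ∇φ` of the perturbed source.
  have h := hφ.2 _ _ (hXv.memH1Zero_sub_integral hW)
  have e1 : ∀ c : ℝ, ∫ x, poissonSource D V f U x * (X x * v x - c) ∂(gibbs D (V + U)) =
      ∫ x, poissonSource D V f U x * (X x * v x) ∂(gibbs D (V + U)) := fun c => by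
    refine mul_left_cancel₀ hW.partitionFunction_pos.ne' ?_
    rw [mul_integral_poissonSource_mul hW, mul_integral_poissonSource_mul hW,
      integral_centredObservable_sub_const hVf (hU.integrable_centredObservable_mul hVf hXv.3)]
  rw [e1] at h
  have hg := hφ.1.1.4
  have i1 : Integrable (fun x => X x * inner ℝ (g x) (k x)) (gibbs D (V + U)) := by
    have := hg.integrable_inner_two (hv.4.bdd_smul hX.continuous.aestronglyMeasurable hC)
    simpa only [inner_smul_right] using this
  have i2 : Integrable (fun x => inner ℝ (gradient X x) (g x) * v x) (gibbs D (V + U)) := by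
    have := hg.integrable_inner_two (hv.3.smul_bdd
      hX.continuous_gradient.aestronglyMeasurable hC')
    refine this.congr (Filter.Eventually.of_forall fun x => ?_)
    simp only [inner_smul_right, real_inner_comm, mul_comm]
  have i3 : Integrable (fun x => poissonSource D V f U x * (X x * v x)) (gibbs D (V + U)) :=
    hU.4.integrable_mul_two hXv.3
  have e2 : ∀ x, perturbedSource D V f U g X x * v x =
      poissonSource D V f U x * (X x * v x) - inner ℝ (gradient X x) (g x) * v x := fun x => by
    unfold perturbedSource; ring
  have e3 : ∀ x, (inner ℝ (g x) (X x • k x + v x • gradient X x) : ℝ) =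
      X x * inner ℝ (g x) (k x) + inner ℝ (gradient X x) (g x) * v x := fun x => by
    rw [inner_add_right, inner_smul_right, inner_smul_right, real_inner_comm (gradient X x)]
    ring
  simp_rw [e3] at h
  rw [integral_add i1 i2] at h
  simp_rw [e2]
  rw [integral_sub i3 i2, ← h]
  ring

end Source

section Perturbation

variable {D : Factor} {V f U : Space d → ℝ} [IsProbabilityMeasure (gibbs D (V + U))]

/-- Recentring a solution at `U + b` for `μ_U` leaves its gradient unchanged. The equation then
lives in the fixed space over `U`, with `b` appearing only as the weight `e^{-b}`. -/
theorem exists_of_isPoissonSolution_add (hVf : IsTargetPair D V f) (hU : IsAdmissible D V f U)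
    {r : h1Zero D (V + U)}
    (hr : ∀ (q : h1Zero D (V + U)) (v : Space d → ℝ) (k : Space d → Space d),
      Represents v k q.1 →
        (inner ℝ r q : ℝ) = ∫ x, poissonSource D V f U x * v x ∂(gibbs D (V + U)))
    {b : Space d →ᵇ ℝ} (hb : D.IsSmooth b) {u : Space d → ℝ} {g : Space d → Space d}
    (h : IsPoissonSolution D V f (U + ⇑b) u g) :
    ∃ p : h1Zero D (V + U), ∃ u' : Space d → ℝ, Represents u' g p.1 ∧
      gradForm D (V + U) (NormedSpace.exp (-b)) p = r := by
  have hW := hU.isPotential hVf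
  have hC := b.norm_coe_le_norm
  have hW' : IsPotential D (V + U + ⇑b) := hW.add_bounded hb hC
  unfold IsPoissonSolution at h
  rw [← add_assoc] at h
  obtain ⟨p, hp⟩ := ((h.1.1.of_add_bounded hW hb hC).memH1Zero_sub_integral
    hW).exists_represents hW
  refine ⟨p, _, hp, ext_inner_right ℝ fun q => ?_⟩
  obtain ⟨v, k, hv, hq⟩ := h1Zero_exists_memH1Zero hW q
  have h2 := h.2 _ _ ((hv.1.add_bounded hW hC).memH1Zero_sub_integral hW')
  rw [inner_gradForm hp hq, hr q v k hq]
  refine mul_left_cancel₀ hW.partitionFunction_pos.ne' ?_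
  rw [← mul_integral_gibbs_add hW hb, mul_integral_poissonSource_mul hW, ← add_assoc, h2,
    add_assoc, mul_integral_poissonSource_mul (by rwa [← add_assoc]),
    integral_centredObservable_sub_const hVf (hU.integrable_centredObservable_mul hVf hv.1.3)]

theorem exists_isPoissonSolution_add (hVf : IsTargetPair D V f) (hU : IsAdmissible D V f U)
    {r : h1Zero D (V + U)}
    (hr : ∀ (q : h1Zero D (V + U)) (v : Space d → ℝ) (k : Space d → Space d),
      Represents v k q.1 →
        (inner ℝ r q : ℝ) = ∫ x, poissonSource D V f U x * v x ∂(gibbs D (V + U)))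
    {b : Space d →ᵇ ℝ} (hb : D.IsSmooth b) :
    ∃ (u : Space d → ℝ) (g : Space d → Space d), IsPoissonSolution D V f (U + ⇑b) u g := by
  have hW := hU.isPotential hVf
  have hC := b.norm_coe_le_norm
  have hW' : IsPotential D (V + U + ⇑b) := hW.add_bounded hb hC
  obtain ⟨p, hp⟩ := (ContinuousLinearMap.isUnit_iff_bijective.1 (isUnit_gradForm hW hU.3
    (Real.exp_pos _) (BoundedContinuousFunction.exp_lower_bound (-b)))).2 r
  obtain ⟨u, g, hug, hrep⟩ := h1Zero_exists_memH1Zero hW p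
  refine ⟨fun x => u x - ∫ y, u y ∂(gibbs D (V + U + ⇑b)), g, ?_⟩
  unfold IsPoissonSolution
  rw [← add_assoc]
  refine ⟨(hug.1.add_bounded hW hC).memH1Zero_sub_integral hW', fun v k hv => ?_⟩
  have hv' := hv.1.of_add_bounded hW hb hC
  obtain ⟨q, hq⟩ := (hv'.memH1Zero_sub_integral hW).exists_represents hW
  have h2 := hr q _ _ hq
  rw [← hp, inner_gradForm hrep hq] at h2
  refine mul_left_cancel₀ hW'.partitionFunction_pos.ne' ?_
  rw [add_assoc, mul_integral_gibbs_add hW hb, h2, mul_integral_poissonSource_mul hW,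
    mul_integral_poissonSource_mul (by rwa [← add_assoc]),
    integral_centredObservable_sub_const hVf (hU.integrable_centredObservable_mul hVf hv'.3)]

/-- Of the two factors `Z[U + b]`, one becomes `Z[U]` times the mean of `e^{-b}`. The other turns
the Dirichlet energy for `μ_{U+b}` into the `e^{-b}`-weighted energy for `μ_U`, which equals `⟪r,
p⟫` for the solution `p`. -/
theorem asymptoticVariance_add (hVf : IsTargetPair D V f) (hU : IsAdmissible D V f U)
    {r : h1Zero D (V + U)}
    (hr : ∀ (q : h1Zero D (V + U)) (v : Space d → ℝ) (k : Space d → Space d),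
      Represents v k q.1 →
        (inner ℝ r q : ℝ) = ∫ x, poissonSource D V f U x * v x ∂(gibbs D (V + U)))
    {b : Space d →ᵇ ℝ} (hb : D.IsSmooth b) :
    asymptoticVariance D V f (U + ⇑b) =
      2 * partitionFunction D (V + U) ^ 2 / partitionFunction D V ^ 2 *
        weightedDualEnergy (gibbsMean D (V + U)) (gradForm D (V + U)) r
          (NormedSpace.exp (-b)) := by
  have hW := hU.isPotential hVf
  have hex : ∃ p : (Space d → ℝ) × (Space d → Space d),
      IsPoissonSolution D V f (U + ⇑b) p.1 p.2 := by
    obtain ⟨u, g, h⟩ := exists_isPoissonSolution_add hVf hU hr hb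
    exact ⟨(u, g), h⟩
  unfold asymptoticVariance
  rw [dif_pos hex]
  obtain ⟨p, u', hp, he⟩ := exists_of_isPoissonSolution_add hVf hU hr hb hex.choose_spec
  have hunit : IsUnit (gradForm D (V + U) (NormedSpace.exp (-b))) :=
    isUnit_gradForm hW hU.3 (Real.exp_pos _) (BoundedContinuousFunction.exp_lower_bound (-b))
  have hinv : Ring.inverse (gradForm D (V + U) (NormedSpace.exp (-b))) r = p := by
    rw [← he]
    exact congrArg (fun S : h1Zero D (V + U) →L[ℝ] h1Zero D (V + U) => S p)
      (Ring.inverse_mul_cancel _ hunit)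
  have h1 := mul_integral_gibbs_add hW hb (fun x => ‖hex.choose.2 x‖ ^ 2)
  have h2 : (inner ℝ r p : ℝ) =
      ∫ x, NormedSpace.exp (-b) x * ‖hex.choose.2 x‖ ^ 2 ∂(gibbs D (V + U)) := by
    rw [← he, inner_gradForm hp hp]
    simp_rw [real_inner_self_eq_norm_sq]
  have h3 := mul_integral_gibbs_add hW hb (fun _ => 1)
  have hW' : IsPotential D (V + (U + ⇑b)) := by
    rw [← add_assoc]; exact hW.add_bounded hb b.norm_coe_le_norm
  have := hW'.isProbabilityMeasure
  simp only [mul_one, integral_const, probReal_univ, smul_eq_mul] at h3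
  unfold weightedDualEnergy
  rw [hinv, gibbsMean_apply, h2, sq (partitionFunction D (V + (U + ⇑b)))]
  calc _ = 2 * partitionFunction D (V + (U + ⇑b)) / partitionFunction D V ^ 2 *
        (partitionFunction D (V + (U + ⇑b)) *
          ∫ x, ‖hex.choose.2 x‖ ^ 2 ∂(gibbs D (V + (U + ⇑b)))) := by ring
    _ = _ := by rw [h1, h3]; ring

end Perturbation

/-! ### First and second variation -/

section Variation

variable {D : Factor} {V f U : Space d → ℝ} [IsProbabilityMeasure (gibbs D (V + U))]

theorem hasDerivAt_exp_neg_add_smul {α : Type*} [TopologicalSpace α] (w u : α →ᵇ ℝ) (s : ℝ) :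
    HasDerivAt (fun t : ℝ => NormedSpace.exp (-(s • w + t • u)))
      (-(NormedSpace.exp (-(s • w)) * u)) 0 := by
  have h := (hasDerivAt_exp_smul_const (𝕂 := ℝ) (-u) (0 : ℝ)).const_mul
    (NormedSpace.exp (-(s • w)))
  have h0 : NormedSpace.exp ((0 : ℝ) • (-u)) = 1 := by
    simp
  rw [h0, one_mul] at h
  refine (h.congr_deriv (by ext x; simp)).congr_of_eventuallyEq
    (Filter.Eventually.of_forall fun t => ?_)
  ext x
  simp only [BoundedContinuousFunction.exp_apply, BoundedContinuousFunction.coe_mul,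
    Pi.mul_apply, BoundedContinuousFunction.coe_neg, Pi.neg_apply,
    BoundedContinuousFunction.coe_add, Pi.add_apply, BoundedContinuousFunction.coe_smul,
    ← Real.exp_add, smul_eq_mul]
  congr 1
  ring

/-- The base point stays at `U` while the weight moves along `e^{-(s w + t u)}`. No admissibility of
`U + s w` has to be proved, since this weight is bounded below by a positive constant. -/
theorem hasLineDerivAt_asymptoticVariance (hVf : IsTargetPair D V f) (hU : IsAdmissible D V f U)
    {r : h1Zero D (V + U)}
    (hr : ∀ (q : h1Zero D (V + U)) (v : Space d → ℝ) (k : Space d → Space d),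
      Represents v k q.1 →
        (inner ℝ r q : ℝ) = ∫ x, poissonSource D V f U x * v x ∂(gibbs D (V + U)))
    {u w : Space d →ᵇ ℝ} (hu : D.IsSmooth u) (hw : D.IsSmooth w) (s : ℝ) :
    HasLineDerivAt ℝ (asymptoticVariance D V f)
      (2 * partitionFunction D (V + U) ^ 2 / partitionFunction D V ^ 2 *
        weightedDualEnergyDeriv (gibbsMean D (V + U)) (gradForm D (V + U)) r
          (NormedSpace.exp (-(s • w))) (-(NormedSpace.exp (-(s • w)) * u)))
      (U + s • ⇑w) ⇑u := by
  have hW := hU.isPotential hVf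
  unfold HasLineDerivAt
  have hc := hasDerivAt_exp_neg_add_smul w u s
  have h0 : NormedSpace.exp (-(s • w + (0 : ℝ) • u)) = NormedSpace.exp (-(s • w)) := by simp
  have h := hasDerivAt_weightedDualEnergy (gibbsMean D (V + U)) (gradForm D (V + U)) r hc
    (isUnit_gradForm hW hU.3 (Real.exp_pos _) (BoundedContinuousFunction.exp_lower_bound _))
  rw [h0] at h
  refine (h.const_mul _).congr_of_eventuallyEq (Filter.Eventually.of_forall fun t => ?_)
  have hs : D.IsSmooth ⇑(s • w + t • u) :=
    ((Factor.isSmooth_const s).mul hw).add ((Factor.isSmooth_const t).mul hu)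
  have e : U + s • ⇑w + t • ⇑u = U + ⇑(s • w + t • u) := by
    ext x; simp [add_assoc]
  dsimp only
  rw [e, asymptoticVariance_add hVf hU hr hs]

theorem hasLineDerivAt_lineDeriv_asymptoticVariance (hVf : IsTargetPair D V f)
    (hU : IsAdmissible D V f U) {γ η : h1Zero D (V + U)}
    (hr : ∀ (q : h1Zero D (V + U)) (v : Space d → ℝ) (k : Space d → Space d),
      Represents v k q.1 → (inner ℝ (gradForm D (V + U) 1 γ) q : ℝ) =
        ∫ x, poissonSource D V f U x * v x ∂(gibbs D (V + U)))
    {u w : Space d →ᵇ ℝ} (hu : D.IsSmooth u) (hw : D.IsSmooth w)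
    (hη : gradForm D (V + U) 1 η = gradForm D (V + U) w γ) :
    HasLineDerivAt ℝ (fun U' => 1 / 2 * lineDeriv ℝ (asymptoticVariance D V f) U' u)
      (partitionFunction D (V + U) ^ 2 / partitionFunction D V ^ 2 *
        (gibbsMean D (V + U) (u * w) * inner ℝ (gradForm D (V + U) 1 γ) γ
          - gibbsMean D (V + U) u * inner ℝ (gradForm D (V + U) w γ) γ
          - gibbsMean D (V + U) w * inner ℝ (gradForm D (V + U) u γ) γ
          - inner ℝ (gradForm D (V + U) (u * w) γ) γ
          + 2 * inner ℝ (gradForm D (V + U) u γ) η)) U ⇑w := by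
  have hW := hU.isPotential hVf
  have he : HasDerivAt (fun s : ℝ => NormedSpace.exp (-(s • w))) (-w) 0 := by
    have h := hasDerivAt_exp_neg_add_smul (0 : Space d →ᵇ ℝ) w 0
    have h0 : NormedSpace.exp (-((0 : ℝ) • (0 : Space d →ᵇ ℝ))) = 1 := by
      simp
    rw [h0, one_mul] at h
    simpa using h
  have he0 : NormedSpace.exp (-((0 : ℝ) • w)) = 1 := by
    simp
  have h := hasDerivAt_weightedDualEnergyDeriv (gibbsMean D (V + U)) (gradForm D (V + U))
    (gradForm_symm hW) he he0 (isUnit_gradForm hW hU.3 one_pos fun x => le_rfl) (by simp) hη u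
  unfold HasLineDerivAt
  refine (h.const_mul (partitionFunction D (V + U) ^ 2 /
    partitionFunction D V ^ 2)).congr_of_eventuallyEq (Filter.Eventually.of_forall fun s => ?_)
  dsimp only
  rw [(hasLineDerivAt_asymptoticVariance hVf hU hr hu hw s).lineDeriv]
  ring

/-- Polynomial identity obtained by expanding the product of the centred directions. It uses `⟪form
1 γ, η⟫ = ⟪form w γ, γ⟫`, which follows from symmetry. -/
theorem secondVariation_eq {H : Type*} [NormedAddCommGroup H] [InnerProductSpace ℝ H]
    [CompleteSpace H] {𝔸 : Type*} [NormedCommRing 𝔸] [NormedAlgebra ℝ 𝔸] (mass : 𝔸 →L[ℝ] ℝ)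
    (form : 𝔸 →L[ℝ] H →L[ℝ] H)
    (hsymm : ∀ a x y, inner ℝ (form a x) y = inner ℝ x (form a y)) (hmass : mass 1 = 1)
    {γ η : H} {u w : 𝔸} (hη : form 1 η = form w γ) :
    mass (u * w) * inner ℝ (form 1 γ) γ - mass u * inner ℝ (form w γ) γ
        - mass w * inner ℝ (form u γ) γ - inner ℝ (form (u * w) γ) γ
        + 2 * inner ℝ (form u γ) η =
      inner ℝ (form ((u - mass u • 1) * (w - mass w • 1)) γ) γ
        + mass ((u - mass u • 1) * (w - mass w • 1)) * inner ℝ (form 1 γ) γ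
        - 2 * (inner ℝ (form ((u - mass u • 1) * (w - mass w • 1)) γ) γ
          - inner ℝ (form (u - mass u • 1) γ) (η - mass w • γ)) := by
  have e : (u - mass u • 1) * (w - mass w • 1) =
      u * w - mass u • w - mass w • u + (mass u * mass w) • (1 : 𝔸) := by
    simp only [sub_mul, mul_sub, smul_mul_assoc, mul_smul_comm, one_mul, mul_one, smul_smul,
      smul_sub]
    rw [mul_comm (mass u)]
    abel
  have e1 : inner ℝ (form 1 γ) η = inner ℝ (form w γ) γ := by
    rw [hsymm, hη, real_inner_comm]
  rw [e]
  simp only [map_add, map_sub, map_smul, add_apply, sub_apply, smul_apply, inner_add_left,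
    inner_sub_left, inner_sub_right, inner_smul_left, inner_smul_right, hmass, smul_eq_mul,
    conj_trivial, e1]
  ring

end Variation

section FormAlgebra

variable {H : Type*} [NormedAddCommGroup H] [InnerProductSpace ℝ H] {𝔸 : Type*}
  [NormedCommRing 𝔸] [NormedAlgebra ℝ 𝔸] (form : 𝔸 →L[ℝ] H →L[ℝ] H)

/-- Passes from the solution for the centred direction to the one for the uncentred direction, which
enters the derivative formula. -/
theorem form_one_add_smul {γ μ : H} {w : 𝔸} {c : ℝ} (h : form 1 μ = form (w - c • 1) γ) :
    form 1 (μ + c • γ) = form w γ := by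
  rw [map_add, h, map_sub, map_smul, map_smul, sub_apply, smul_apply, sub_add_cancel]

/-- Here `κ` and `μ` are the projections of `x γ` and `y γ` in the energy sense, so all mixed terms
but one cancel, as for the inner product of two projection residuals. -/
theorem residual_form_eq (hsymm : ∀ a x y, inner ℝ (form a x) y = inner ℝ x (form a y))
    {γ κ μ : H} {x y : 𝔸} (hκ : form 1 κ = form x γ) (hμ : form 1 μ = form y γ) :
    inner ℝ (form 1 κ) μ - inner ℝ (form x γ) μ -
        (inner ℝ (form y γ) κ - inner ℝ (form (x * y) γ) γ) =
      inner ℝ (form (x * y) γ) γ - inner ℝ (form x γ) μ := by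
  rw [← hμ, hsymm 1 μ κ, hκ, real_inner_comm μ]
  ring

end FormAlgebra

/-! ### Identification of the abstract terms with the stated integrals -/

section SecondVariation

variable {D : Factor} {V f U : Space d → ℝ} [IsProbabilityMeasure (gibbs D (V + U))]

/-- The centred perturbation as a bounded continuous function. -/
def centreBCF (D : Factor) (V U : Space d → ℝ) [IsProbabilityMeasure (gibbs D (V + U))]
    (a : Space d →ᵇ ℝ) : Space d →ᵇ ℝ :=
  a - gibbsMean D (V + U) a • 1

theorem coe_centreBCF (a : Space d →ᵇ ℝ) : ⇑(centreBCF D V U a) = centre D V U a := by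
  ext x
  simp [centreBCF, centre]

theorem inner_gradForm_eq_integral_perturbedSource (hVf : IsTargetPair D V f)
    (hU : IsAdmissible D V f U) {φ : Space d → ℝ} {g : Space d → Space d}
    (hφ : IsPoissonSolution D V f U φ g) {γ : h1Zero D (V + U)} (hγ : Represents φ g γ.1)
    {X : Space d → ℝ} (hX : D.IsTest X) (q : h1Zero D (V + U)) (v : Space d → ℝ)
    (k : Space d → Space d) (hv : MemH1Zero D (V + U) v k) (hq : Represents v k q.1) :
    (inner ℝ (gradForm D (V + U) (centreBCF D V U hX.toBCF) γ) q : ℝ) =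
      ∫ x, perturbedSource D V f U g (centre D V U X) x * v x ∂(gibbs D (V + U)) := by
  have hs : D.IsSmooth (centre D V U X) := hX.1.sub (Factor.isSmooth_const _)
  have hc : ⇑(centreBCF D V U hX.toBCF) = centre D V U X := coe_centreBCF _
  obtain ⟨C', hC'⟩ := hX.exists_bound_gradient
  have hgrad : gradient (centre D V U X) = gradient X := by
    ext1 x
    unfold gradient centre
    rw [fderiv_sub_const]
  rw [inner_gradForm hγ hq, integral_perturbedSource_mul hVf hU hφ hs
    (C := ‖centreBCF D V U hX.toBCF‖) (C' := C') (fun x => ?_) (fun x => by rw [hgrad]; exact hC' x)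
    hv.1, hc]
  rw [← hc]
  exact BoundedContinuousFunction.norm_coe_le_norm _ x

set_option maxHeartbeats 1000000 in
theorem weightedTerm_eq (hW : IsPotential D (V + U)) {φ : Space d → ℝ} {g : Space d → Space d}
    {γ : h1Zero D (V + U)} (hγ : Represents φ g γ.1) (a b : Space d →ᵇ ℝ) :
    weightedTerm D V U g (centre D V U a) (centre D V U b) =
      partitionFunction D (V + U) ^ 2 / partitionFunction D V ^ 2 *
        (inner ℝ (gradForm D (V + U) (centreBCF D V U a * centreBCF D V U b) γ) γ +
          gibbsMean D (V + U) (centreBCF D V U a * centreBCF D V U b) *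
            inner ℝ (gradForm D (V + U) 1 γ) γ) := by
  have hg : MemLp g 2 (gibbs D (V + U)) := (memLp_congr_ae hγ.2).1 (Lp.memLp _)
  set c := centreBCF D V U a * centreBCF D V U b with hc
  have i1 : Integrable (fun x => c x * ‖g x‖ ^ 2) (gibbs D (V + U)) := by
    have := (hg.bdd_smul c.continuous.aestronglyMeasurable
      c.norm_coe_le_norm).integrable_inner_two hg
    simpa only [inner_smul_left, real_inner_self_eq_norm_sq, conj_trivial] using this
  have e : ∀ x, centre D V U a x * centre D V U b x = c x := fun x => by
    rw [hc, ← coe_centreBCF, ← coe_centreBCF]; rfl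
  unfold weightedTerm
  simp_rw [e]
  rw [← partitionFunction_mul_integral_gibbs hW, inner_gradForm hγ hγ, inner_gradForm hγ hγ,
    gibbsMean_apply]
  simp_rw [real_inner_self_eq_norm_sq, mul_add]
  rw [integral_add i1 ((c.integrable _).mul_const _), integral_mul_const]
  simp only [BoundedContinuousFunction.coe_one, Pi.one_apply, one_mul]
  ring

set_option maxHeartbeats 1000000 in
theorem integral_inner_residual {φ ψ χ : Space d → ℝ} {g k l : Space d → Space d}
    {γ κ μ : h1Zero D (V + U)} (hγ : Represents φ g γ.1)
    (hκ : Represents ψ k κ.1) (hμ : Represents χ l μ.1) (x y : Space d →ᵇ ℝ) :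
    ∫ z, inner ℝ (k z - x z • g z) (l z - y z • g z) ∂(gibbs D (V + U)) =
      inner ℝ (gradForm D (V + U) 1 κ) μ - inner ℝ (gradForm D (V + U) x γ) μ -
        (inner ℝ (gradForm D (V + U) y γ) κ - inner ℝ (gradForm D (V + U) (x * y) γ) γ) := by
  have hg : MemLp g 2 (gibbs D (V + U)) := (memLp_congr_ae hγ.2).1 (Lp.memLp _)
  have hk : MemLp k 2 (gibbs D (V + U)) := (memLp_congr_ae hκ.2).1 (Lp.memLp _)
  have hl : MemLp l 2 (gibbs D (V + U)) := (memLp_congr_ae hμ.2).1 (Lp.memLp _)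
  have key : ∀ (c : Space d →ᵇ ℝ) {m n : Space d → Space d}, MemLp m 2 (gibbs D (V + U)) →
      MemLp n 2 (gibbs D (V + U)) →
      Integrable (fun z => c z * inner ℝ (m z) (n z)) (gibbs D (V + U)) := by
    intro c m n hm hn
    have := (hm.bdd_smul c.continuous.aestronglyMeasurable
      c.norm_coe_le_norm).integrable_inner_two hn
    simpa only [inner_smul_left, conj_trivial] using this
  have e : ∀ z, (inner ℝ (k z - x z • g z) (l z - y z • g z) : ℝ) =
      (1 : Space d →ᵇ ℝ) z * inner ℝ (k z) (l z) - x z * inner ℝ (g z) (l z) -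
        (y z * inner ℝ (g z) (k z) - (x * y) z * inner ℝ (g z) (g z)) := fun z => by
    simp only [inner_sub_left, inner_sub_right, inner_smul_left, inner_smul_right, conj_trivial,
      BoundedContinuousFunction.coe_one, Pi.one_apply, one_mul, BoundedContinuousFunction.coe_mul,
      Pi.mul_apply, real_inner_comm (g z) (k z)]
    ring
  calc _ = _ := integral_congr_ae (Filter.Eventually.of_forall e)
    _ = _ := integral_sub ((key 1 hk hl).sub (key x hg hl))
      ((key y hg hk).sub (key (x * y) hg hg))
    _ = _ := by
      rw [integral_sub (key 1 hk hl) (key x hg hl),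
        integral_sub (key y hg hk) (key (x * y) hg hg), inner_gradForm hκ hμ,
        inner_gradForm hγ hμ, inner_gradForm hγ hκ, inner_gradForm hγ hγ]

set_option maxHeartbeats 1000000 in
theorem gradientTerm_eq (hW : IsPotential D (V + U)) {φ ψ χ : Space d → ℝ}
    {g k l : Space d → Space d} {γ κ μ : h1Zero D (V + U)} (hγ : Represents φ g γ.1)
    (hκ : Represents ψ k κ.1) (hμ : Represents χ l μ.1) {a b : Space d →ᵇ ℝ}
    (ha : gradForm D (V + U) 1 κ = gradForm D (V + U) (centreBCF D V U a) γ)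
    (hb : gradForm D (V + U) 1 μ = gradForm D (V + U) (centreBCF D V U b) γ) :
    gradientTerm D V U g (centre D V U a) (centre D V U b) k l =
      partitionFunction D (V + U) ^ 2 / partitionFunction D V ^ 2 *
        (2 * (inner ℝ (gradForm D (V + U) (centreBCF D V U a * centreBCF D V U b) γ) γ -
          inner ℝ (gradForm D (V + U) (centreBCF D V U a) γ) μ)) := by
  unfold gradientTerm
  rw [← partitionFunction_mul_integral_gibbs hW, ← coe_centreBCF, ← coe_centreBCF,
    integral_inner_residual hγ hκ hμ, residual_form_eq _ (gradForm_symm hW) ha hb]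
  ring

end SecondVariation

/-! ### Well-posedness and the second variation formula -/

theorem IsAdmissible.wellPosed_poisson {D : Factor} {V f U : Space d → ℝ}
    (hVf : IsTargetPair D V f) (hU : IsAdmissible D V f U) :
    WellPosed D (V + U) (poissonSource D V f U) := by
  have hW := hU.isPotential hVf
  have := hW.isProbabilityMeasure
  obtain ⟨r, hr⟩ := exists_source_vector hU.4
  exact wellPosed_of_source_vector hW hU.3 fun q v k _ hq => hr q v k hq

theorem IsAdmissible.wellPosed_perturbed {D : Factor} {V f U : Space d → ℝ}
    (hVf : IsTargetPair D V f) (hU : IsAdmissible D V f U) {φ : Space d → ℝ}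
    {g : Space d → Space d} (hφ : IsPoissonSolution D V f U φ g) {X : Space d → ℝ}
    (hX : D.IsTest X) :
    WellPosed D (V + U) (perturbedSource D V f U g (centre D V U X)) := by
  have hW := hU.isPotential hVf
  have := hW.isProbabilityMeasure
  obtain ⟨γ, hγ⟩ := hφ.1.exists_represents hW
  exact wellPosed_of_source_vector hW hU.3
    (inner_gradForm_eq_integral_perturbedSource hVf hU hφ hγ hX)

theorem IsAdmissible.lineDifferentiableAt {D : Factor} {V f U : Space d → ℝ}
    (hVf : IsTargetPair D V f) (hU : IsAdmissible D V f U) {X Y : Space d → ℝ}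
    (hX : D.IsTest X) (hY : D.IsTest Y) (s : ℝ) :
    LineDifferentiableAt ℝ (asymptoticVariance D V f) (U + s • Y) X := by
  have := (hU.isPotential hVf).isProbabilityMeasure
  obtain ⟨r, hr⟩ := exists_source_vector hU.4
  exact (hasLineDerivAt_asymptoticVariance hVf hU hr (u := hX.toBCF) (w := hY.toBCF)
    hX.1 hY.1 s).lineDifferentiableAt

set_option maxHeartbeats 1000000 in
theorem IsAdmissible.hasLineDerivAt_lineDeriv {D : Factor} {V f U : Space d → ℝ}
    (hVf : IsTargetPair D V f) (hU : IsAdmissible D V f U) {φ : Space d → ℝ}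
    {g : Space d → Space d} (hφ : IsPoissonSolution D V f U φ g) {X Y : Space d → ℝ}
    (hX : D.IsTest X) (hY : D.IsTest Y) {ψ χ : Space d → ℝ} {k l : Space d → Space d}
    (hψ : IsWeakSolution D (V + U) (perturbedSource D V f U g (centre D V U X)) ψ k)
    (hχ : IsWeakSolution D (V + U) (perturbedSource D V f U g (centre D V U Y)) χ l) :
    HasLineDerivAt ℝ (fun U' => 1 / 2 * lineDeriv ℝ (asymptoticVariance D V f) U' X)
      (weightedTerm D V U g (centre D V U X) (centre D V U Y) -
        gradientTerm D V U g (centre D V U X) (centre D V U Y) k l) U Y := by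
  have hW := hU.isPotential hVf
  have := hW.isProbabilityMeasure
  obtain ⟨r, hr⟩ := exists_source_vector hU.4
  obtain ⟨γ, hγ⟩ := hφ.1.exists_represents hW
  obtain ⟨κ, hκ⟩ := hψ.1.exists_represents hW
  obtain ⟨μ, hμ⟩ := hχ.1.exists_represents hW
  have eγ := (isWeakSolution_iff hW (fun q v k _ hq => hr q v k hq) hφ.1 hγ).1 hφ
  have eκ := (isWeakSolution_iff hW
    (inner_gradForm_eq_integral_perturbedSource hVf hU hφ hγ hX) hψ.1 hκ).1 hψ
  have eμ := (isWeakSolution_iff hW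
    (inner_gradForm_eq_integral_perturbedSource hVf hU hφ hγ hY) hχ.1 hμ).1 hχ
  -- From here on the source vector is `A_1 γ`, as the derivative formula requires.
  subst eγ
  -- The derivative involves the uncentred direction `Y`, whereas `χ` solves the equation for the
  -- centred one. The two solutions differ by `μ_U(Y) γ`, which cancels again two lines below.
  have eη := form_one_add_smul (gradForm D (V + U)) eμ
  have h := hasLineDerivAt_lineDeriv_asymptoticVariance hVf hU hr (u := hX.toBCF)
    (w := hY.toBCF) hX.1 hY.1 eη
  rw [secondVariation_eq _ _ (gradForm_symm hW) (by simp) eη, add_sub_cancel_right] at h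
  have e1 := weightedTerm_eq hW hγ hX.toBCF hY.toBCF
  have e2 := gradientTerm_eq hW hγ hκ hμ eκ eμ
  rw [Factor.IsTest.coe_toBCF, Factor.IsTest.coe_toBCF] at e1 e2
  rw [e1, e2, ← mul_sub]
  exact h

/-! ### One-dimensional problems on the line -/

theorem Space.eq_single (x : Space 1) : x = EuclideanSpace.single 0 (x 0) := by
  ext i
  rw [Subsingleton.elim i 0]
  simp

theorem Space.inner_one (x y : Space 1) : (inner ℝ x y : ℝ) = x 0 * y 0 := by
  simp [PiLp.inner_apply, mul_comm]

/-- A compactly supported smooth function on the line has a bounded smooth primitive. -/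
theorem exists_bounded_primitive {η : Space 1 → ℝ} (hη : ContDiff ℝ ∞ η)
    (hs : HasCompactSupport η) :
    ∃ P : Space 1 → ℝ, Factor.line.IsSmooth P ∧ (∃ C, ∀ x, ‖P x‖ ≤ C) ∧
      ∀ x, gradient P x = η x • EuclideanSpace.single 0 1 := by
  let L : ℝ →L[ℝ] Space 1 := ContinuousLinearMap.smulRight (1 : ℝ →L[ℝ] ℝ)
    (EuclideanSpace.single 0 1)
  let π₀ : Space 1 →L[ℝ] ℝ := EuclideanSpace.proj 0
  have hL : ∀ t, L t = EuclideanSpace.single 0 t := fun t => by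
    ext i; rw [Subsingleton.elim i 0]; simp [L]
  have hLπ : ∀ x, L (π₀ x) = x := fun x => by
    rw [hL]; exact (Space.eq_single x).symm
  have hπL : ∀ t, π₀ (L t) = t := fun t => by rw [hL]; simp [π₀]
  let m : ℝ → ℝ := fun t => η (L t)
  have hm : ContDiff ℝ ∞ m := hη.comp L.contDiff
  have hms : HasCompactSupport m :=
    hs.comp_isClosedEmbedding (Topology.IsClosedEmbedding.of_continuous_injective_isClosedMap
      L.continuous (Function.LeftInverse.injective hπL) (fun s hs => by
        have : L '' s = π₀ ⁻¹' s := by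
          ext x
          exact ⟨fun ⟨t, ht, e⟩ => by rw [← e, Set.mem_preimage, hπL]; exact ht,
            fun hx => ⟨π₀ x, hx, hLπ x⟩⟩
        rw [this]
        exact hs.preimage π₀.continuous))
  have hmc : Continuous m := hm.continuous
  have hmi : Integrable m := hmc.integrable_of_hasCompactSupport hms
  let Q : ℝ → ℝ := fun s => ∫ t in (0 : ℝ)..s, m t
  have hQ : ∀ s, HasDerivAt Q (m s) s := fun s => hmc.integral_hasStrictDerivAt 0 s |>.hasDerivAt
  have hQc : ContDiff ℝ ∞ Q := contDiff_infty_iff_deriv.2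
    ⟨fun s => (hQ s).differentiableAt, by
      have : deriv Q = m := funext fun s => (hQ s).deriv
      rw [this]; exact hm⟩
  -- The primitive is bounded by the `L¹` norm of the integrand but need not have compact support.
  -- It is therefore used as a bounded Sobolev function, not as a test function.
  refine ⟨fun x => Q (π₀ x), ⟨trivial, hQc.comp π₀.contDiff⟩, ⟨∫ t, ‖m t‖, fun x => ?_⟩,
    fun x => ?_⟩
  · refine (intervalIntegral.norm_integral_le_integral_norm_uIoc).trans ?_
    exact setIntegral_le_integral hmi.norm (Filter.Eventually.of_forall fun t => norm_nonneg _)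
  · have h1 : HasFDerivAt (fun x => Q (π₀ x)) (m (π₀ x) • π₀) x :=
      (hQ (π₀ x)).comp_hasFDerivAt x π₀.hasFDerivAt
    refine ext_inner_right ℝ fun v => ?_
    rw [inner_gradient_left, h1.fderiv]
    simp only [smul_apply, smul_eq_mul, m, hLπ, inner_smul_left, conj_trivial,
      Space.inner_one]
    simp [π₀]

theorem ae_eq_of_integral_test_mul_eq {h h' : Space 1 → ℝ} (hh : LocallyIntegrable h)
    (hh' : LocallyIntegrable h')
    (H : ∀ η : Space 1 → ℝ, ContDiff ℝ ∞ η → HasCompactSupport η →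
      ∫ x, η x * h x = ∫ x, η x * h' x) : h =ᵐ[volume] h' := by
  have h0 := ae_eq_zero_of_integral_contDiff_smul_eq_zero (hh.sub hh') (fun η hη hs => by
    have i : ∀ {k : Space 1 → ℝ}, LocallyIntegrable k → Integrable (fun x => η x * k x) :=
      fun hk => hk.integrable_smul_left_of_hasCompactSupport hη.continuous hs
    simp only [Pi.sub_apply, smul_eq_mul, mul_sub]
    rw [integral_sub (i hh) (i hh'), H η hη hs, sub_self])
  filter_upwards [h0] with x hx
  exact sub_eq_zero.1 hx

theorem memH1_of_gradient_eq {W P η : Space 1 → ℝ} (hW : IsPotential Factor.line W)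
    (hη : ContDiff ℝ ∞ η) (hs : HasCompactSupport η) (hP : Factor.line.IsSmooth P) {C : ℝ}
    (hC : ∀ x, ‖P x‖ ≤ C) (hg : ∀ x, gradient P x = η x • EuclideanSpace.single 0 1) :
    MemH1 Factor.line W P (fun x => η x • EuclideanSpace.single 0 1) := by
  have := hW.isProbabilityMeasure
  have e : gradient P = fun x => η x • EuclideanSpace.single 0 1 := funext hg
  obtain ⟨C', hC'⟩ := hs.exists_bound_of_continuous hη.continuous
  rw [← e]
  refine MemH1.of_isSmooth hP
    (MemLp.of_bound hP.continuous.aestronglyMeasurable C (Filter.Eventually.of_forall hC)) ?_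
  refine MemLp.of_bound hP.continuous_gradient.aestronglyMeasurable C'
    (Filter.Eventually.of_forall fun x => ?_)
  rw [hg, norm_smul]
  simpa using hC' x

/-- The flux `g e^{-W}` of a square integrable field. -/
def flux (W : Space 1 → ℝ) (g : Space 1 → Space 1) : Space 1 → ℝ :=
  fun x => g x 0 * Real.exp (-W x)

theorem integrable_flux {W : Space 1 → ℝ} (hW : IsPotential Factor.line W)
    {g : Space 1 → Space 1} (hg : MemLp g 2 (gibbs Factor.line W)) :
    Integrable (flux W g) volume := by
  have := hW.isProbabilityMeasure
  have h := hW.integrable_iff.1 (hg.integrable (by norm_num))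
  have h2 := (EuclideanSpace.proj (𝕜 := ℝ) (0 : Fin 1)).integrable_comp h
  refine h2.congr (Filter.Eventually.of_forall fun x => ?_)
  simp [flux, mul_comm]

theorem integral_test_mul_flux {W : Space 1 → ℝ} (hW : IsPotential Factor.line W)
    (g : Space 1 → Space 1) (η : Space 1 → ℝ) :
    ∫ x, η x * flux W g x = partitionFunction Factor.line W *
      ∫ x, inner ℝ (g x) (η x • EuclideanSpace.single 0 1) ∂(gibbs Factor.line W) := by
  rw [partitionFunction_mul_integral_gibbs hW]
  refine integral_congr_ae (Filter.Eventually.of_forall fun x => ?_)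
  simp only [flux, Space.inner_one, inner_smul_right]
  simp
  ring

/-- On the line, a field orthogonal to all gradients vanishes. -/
theorem ae_eq_zero_of_orthogonal_gradients {W : Space 1 → ℝ} (hW : IsPotential Factor.line W)
    {ρ : Space 1 → Space 1} (hρ : MemLp ρ 2 (gibbs Factor.line W))
    (H : ∀ (v : Space 1 → ℝ) (k : Space 1 → Space 1), MemH1Zero Factor.line W v k →
      ∫ x, inner ℝ (ρ x) (k x) ∂(gibbs Factor.line W) = 0) : ρ =ᵐ[volume] 0 := by
  have h0 : flux W ρ =ᵐ[volume] fun _ => 0 := by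
    refine ae_eq_of_integral_test_mul_eq (integrable_flux hW hρ).locallyIntegrable
      (locallyIntegrable_const 0) (fun η hη hs => ?_)
    -- An arbitrary test field is the gradient of `P`, and centring `P` does not change that
    -- gradient. Orthogonality to gradients is thus orthogonality to all test fields.
    obtain ⟨P, hP, ⟨C, hC⟩, hg⟩ := exists_bounded_primitive hη hs
    rw [integral_test_mul_flux hW,
      H _ _ ((memH1_of_gradient_eq hW hη hs hP hC hg).memH1Zero_sub_integral hW)]
    simp
  filter_upwards [h0] with x hx
  have hx0 : ρ x 0 = 0 := (mul_eq_zero.1 hx).resolve_right (Real.exp_pos _).ne'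
  rw [Space.eq_single (ρ x), hx0]
  simp

/-- The residual `∇ψ - X ∇φ` is orthogonal to all gradients by the equation of `ψ`, so it vanishes
on the line. One vanishing factor is enough. -/
theorem gradientTerm_eq_zero {V f U : Space 1 → ℝ} (hVf : IsTargetPair Factor.line V f)
    (hU : IsAdmissible Factor.line V f U) {φ : Space 1 → ℝ} {g : Space 1 → Space 1}
    (hφ : IsPoissonSolution Factor.line V f U φ g) {X Y : Space 1 → ℝ}
    (hX : Factor.line.IsTest X) {ψ : Space 1 → ℝ} {k l : Space 1 → Space 1}
    (hψ : IsWeakSolution Factor.line (V + U)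
      (perturbedSource Factor.line V f U g (centre Factor.line V U X)) ψ k) :
    gradientTerm Factor.line V U g (centre Factor.line V U X) (centre Factor.line V U Y) k l
      = 0 := by
  have hW := hU.isPotential hVf
  have := hW.isProbabilityMeasure
  have hc : ⇑(centreBCF Factor.line V U hX.toBCF) = centre Factor.line V U X := coe_centreBCF _
  obtain ⟨γ, hγ⟩ := hφ.1.exists_represents hW
  have hXg : MemLp (fun x => centre Factor.line V U X x • g x) 2 (gibbs Factor.line (V + U)) := by
    rw [← hc]
    exact hφ.1.1.4.bdd_smul (BoundedContinuousFunction.continuous _).aestronglyMeasurable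
      (BoundedContinuousFunction.norm_coe_le_norm _)
  have h0 := ae_eq_zero_of_orthogonal_gradients hW (hψ.1.1.4.sub hXg) (fun v m hv => by
    obtain ⟨q, hq⟩ := hv.exists_represents hW
    simp only [Pi.sub_apply, inner_sub_left]
    rw [integral_sub (hψ.1.1.4.integrable_inner_two hv.1.4) (hXg.integrable_inner_two hv.1.4),
      hψ.2 v m hv, ← inner_gradForm_eq_integral_perturbedSource hVf hU hφ hγ hX q v m hv hq,
      inner_gradForm hγ hq, hc]
    simp only [inner_smul_left, conj_trivial, sub_self])
  unfold gradientTerm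
  have h1 : ∫ x, inner ℝ (k x - centre Factor.line V U X x • g x)
      (l x - centre Factor.line V U Y x • g x) * Real.exp (-(V + U) x) ∂(Factor.line.leb 1) =
      0 := by
    refine integral_eq_zero_of_ae ?_
    filter_upwards [h0] with x hx
    have hx' : k x - centre Factor.line V U X x • g x = 0 := hx
    simp [hx']
  rw [h1, mul_zero]

/-! ### Convexity on the line -/

theorem asymptoticVariance_nonneg {D : Factor} {V f U : Space d → ℝ} :
    0 ≤ asymptoticVariance D V f U := by
  unfold asymptoticVariance
  split_ifs
  · exact mul_nonneg (by positivity) (integral_nonneg fun x => by positivity)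
  · exact le_rfl

/-- Weak form of `-J' = (f - I) e^{-V}` for the flux `J`, tested with a primitive `P` of `η`. The
right-hand side does not involve `U`. -/
theorem integral_test_mul_flux_eq {V f U : Space 1 → ℝ} (hVf : IsTargetPair Factor.line V f)
    (hW : IsPotential Factor.line (V + U)) {φ : Space 1 → ℝ} {g : Space 1 → Space 1}
    (h : IsPoissonSolution Factor.line V f U φ g) {P η : Space 1 → ℝ} (hη : ContDiff ℝ ∞ η)
    (hs : HasCompactSupport η) (hP : Factor.line.IsSmooth P) {C : ℝ} (hC : ∀ x, ‖P x‖ ≤ C)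
    (hg : ∀ x, gradient P x = η x • EuclideanSpace.single 0 1) :
    ∫ x, η x * flux (V + U) g x =
      ∫ x, centredObservable Factor.line V f x * P x * Real.exp (-V x) ∂(Factor.line.leb 1) := by
  have hi : Integrable (fun x => centredObservable Factor.line V f x * P x * Real.exp (-V x))
      (Factor.line.leb 1) := by
    have := memLp_one_iff_integrable.1 ((memLp_one_iff_integrable.2
      (integrable_centredObservable hVf)).bdd_smul hP.continuous.aestronglyMeasurable hC)
    refine this.congr (Filter.Eventually.of_forall fun x => ?_)
    simp only [smul_eq_mul]
    ring
  rw [integral_test_mul_flux hW, h.2 _ _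
    ((memH1_of_gradient_eq hW hη hs hP hC hg).memH1Zero_sub_integral hW),
    mul_integral_poissonSource_mul hW, integral_centredObservable_sub_const hVf hi]

theorem flux_ae_eq {V f U U' : Space 1 → ℝ} (hVf : IsTargetPair Factor.line V f)
    (hW : IsPotential Factor.line (V + U)) (hW' : IsPotential Factor.line (V + U'))
    {φ φ' : Space 1 → ℝ} {g g' : Space 1 → Space 1}
    (h : IsPoissonSolution Factor.line V f U φ g)
    (h' : IsPoissonSolution Factor.line V f U' φ' g') :
    flux (V + U) g =ᵐ[volume] flux (V + U') g' := by
  refine ae_eq_of_integral_test_mul_eq (integrable_flux hW h.1.1.4).locallyIntegrable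
    (integrable_flux hW' h'.1.1.4).locallyIntegrable (fun η hη hs => ?_)
  obtain ⟨P, hP, ⟨C, hC⟩, hg⟩ := exists_bounded_primitive hη hs
  rw [integral_test_mul_flux_eq hVf hW h hη hs hP hC hg,
    integral_test_mul_flux_eq hVf hW' h' hη hs hP hC hg]

/-- The Dirichlet energy through the flux, and the integrability of its density. -/
theorem energy_eq_integral_flux {W : Space 1 → ℝ} (hW : IsPotential Factor.line W)
    {g : Space 1 → Space 1} (hg : MemLp g 2 (gibbs Factor.line W)) {J : Space 1 → ℝ}
    (hJ : flux W g =ᵐ[volume] J) :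
    Integrable (fun x => J x ^ 2 * Real.exp (W x)) volume ∧
      partitionFunction Factor.line W * ∫ x, ‖g x‖ ^ 2 ∂(gibbs Factor.line W) =
        ∫ x, J x ^ 2 * Real.exp (W x) := by
  have e : (fun x => ‖g x‖ ^ 2 * Real.exp (-W x)) =ᵐ[volume]
      fun x => J x ^ 2 * Real.exp (W x) := by
    filter_upwards [hJ] with x hx
    rw [← hx, flux, ← real_inner_self_eq_norm_sq, Space.inner_one, Real.exp_neg]
    field_simp
  constructor
  · have h1 := hg.integrable_inner_two hg
    simp_rw [real_inner_self_eq_norm_sq] at h1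
    refine ((hW.integrable_iff.1 h1).congr
      (Filter.Eventually.of_forall fun x => ?_)).congr e
    simp [mul_comm]
  · rw [partitionFunction_mul_integral_gibbs hW]
    exact integral_congr_ae e

/-- By Fubini each product is a double integral of `G(y) e^{W(y) - W(x)}`. The exponent is affine in
`W`, so convexity of the exponential gives the inequality pointwise. -/
theorem integral_mul_integral_convex {α : Type*} [MeasurableSpace α] {ν : Measure α}
    [SigmaFinite ν] {W₀ W₁ G : α → ℝ} {t : ℝ} (ht0 : 0 ≤ t) (ht1 : t ≤ 1) (hG : ∀ x, 0 ≤ G x)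
    (i₀ : Integrable (fun x => Real.exp (-W₀ x)) ν) (i₁ : Integrable (fun x => Real.exp (-W₁ x)) ν)
    (i : Integrable (fun x => Real.exp (-((1 - t) * W₀ x + t * W₁ x))) ν)
    (j₀ : Integrable (fun x => G x * Real.exp (W₀ x)) ν)
    (j₁ : Integrable (fun x => G x * Real.exp (W₁ x)) ν)
    (j : Integrable (fun x => G x * Real.exp ((1 - t) * W₀ x + t * W₁ x)) ν) :
    (∫ x, Real.exp (-((1 - t) * W₀ x + t * W₁ x)) ∂ν) *
        ∫ x, G x * Real.exp ((1 - t) * W₀ x + t * W₁ x) ∂ν ≤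
      (1 - t) * ((∫ x, Real.exp (-W₀ x) ∂ν) * ∫ x, G x * Real.exp (W₀ x) ∂ν) +
        t * ((∫ x, Real.exp (-W₁ x) ∂ν) * ∫ x, G x * Real.exp (W₁ x) ∂ν) := by
  rw [← integral_prod_mul, ← integral_prod_mul, ← integral_prod_mul, ← integral_const_mul,
    ← integral_const_mul,
    ← integral_add ((i₀.mul_prod j₀).const_mul _) ((i₁.mul_prod j₁).const_mul _)]
  refine integral_mono (i.mul_prod j)
    (((i₀.mul_prod j₀).const_mul _).add ((i₁.mul_prod j₁).const_mul _)) fun z => ?_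
  have hc := convexOn_exp.2 (Set.mem_univ (W₀ z.2 - W₀ z.1)) (Set.mem_univ (W₁ z.2 - W₁ z.1))
    (sub_nonneg.2 ht1) ht0 (by ring)
  simp only [smul_eq_mul] at hc
  have key : ∀ a b : ℝ, Real.exp (-a) * (G z.2 * Real.exp b) = G z.2 * Real.exp (b - a) :=
    fun a b => by rw [sub_eq_neg_add, Real.exp_add]; ring
  dsimp only
  rw [key, key, key]
  have e : (1 - t) * W₀ z.2 + t * W₁ z.2 - ((1 - t) * W₀ z.1 + t * W₁ z.1) =
      (1 - t) * (W₀ z.2 - W₀ z.1) + t * (W₁ z.2 - W₁ z.1) := by ring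
  rw [e]
  have := mul_le_mul_of_nonneg_left hc (hG z.2)
  linarith

theorem IsPotential.convex_combination {D : Factor} {W₀ W₁ : Space d → ℝ}
    (h₀ : IsPotential D W₀) (h₁ : IsPotential D W₁) {t : ℝ} (ht0 : 0 ≤ t) (ht1 : t ≤ 1) :
    IsPotential D (fun x => (1 - t) * W₀ x + t * W₁ x) := by
  have hs : D.IsSmooth (fun x => (1 - t) * W₀ x + t * W₁ x) :=
    ((Factor.isSmooth_const (1 - t)).mul h₀.1).add ((Factor.isSmooth_const t).mul h₁.1)
  refine ⟨hs, ?_⟩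
  have hsc := hs.continuous
  refine ((h₀.2.const_mul (1 - t)).add (h₁.2.const_mul t)).mono'
    (Continuous.aestronglyMeasurable (by fun_prop)) (Filter.Eventually.of_forall fun x => ?_)
  have hc := convexOn_exp.2 (Set.mem_univ (-W₀ x)) (Set.mem_univ (-W₁ x))
    (sub_nonneg.2 ht1) ht0 (by ring)
  simp only [smul_eq_mul] at hc
  rw [Real.norm_eq_abs, Real.abs_exp]
  have e : -((1 - t) * W₀ x + t * W₁ x) = (1 - t) * -W₀ x + t * -W₁ x := by ring
  rw [e]
  exact hc

theorem exists_asymptoticVariance_eq {D : Factor} {V f U : Space d → ℝ}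
    (hex : ∃ p : (Space d → ℝ) × (Space d → Space d), IsPoissonSolution D V f U p.1 p.2) :
    ∃ (u : Space d → ℝ) (g : Space d → Space d), IsPoissonSolution D V f U u g ∧
      asymptoticVariance D V f U = 2 / partitionFunction D V ^ 2 *
        (partitionFunction D (V + U) *
          (partitionFunction D (V + U) * ∫ x, ‖g x‖ ^ 2 ∂(gibbs D (V + U)))) := by
  refine ⟨_, _, hex.choose_spec, ?_⟩
  unfold asymptoticVariance
  rw [dif_pos hex]
  ring

/-- A convex combination of admissible potentials is not claimed to be admissible. Only a weak
solution is used there, and its absence makes the left-hand side zero. -/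
theorem asymptoticVariance_convex {V f : Space 1 → ℝ} (hVf : IsTargetPair Factor.line V f)
    {U₀ U₁ : Space 1 → ℝ} (h₀ : IsAdmissible Factor.line V f U₀)
    (h₁ : IsAdmissible Factor.line V f U₁) {t : ℝ} (ht0 : 0 ≤ t) (ht1 : t ≤ 1) :
    asymptoticVariance Factor.line V f ((1 - t) • U₀ + t • U₁) ≤
      (1 - t) * asymptoticVariance Factor.line V f U₀ +
        t * asymptoticVariance Factor.line V f U₁ := by
  by_cases hex : ∃ p : (Space 1 → ℝ) × (Space 1 → Space 1),
      IsPoissonSolution Factor.line V f ((1 - t) • U₀ + t • U₁) p.1 p.2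
  swap
  · have : asymptoticVariance Factor.line V f ((1 - t) • U₀ + t • U₁) = 0 := by
      unfold asymptoticVariance
      rw [dif_neg hex]
    rw [this]
    exact add_nonneg (mul_nonneg (sub_nonneg.2 ht1) asymptoticVariance_nonneg)
      (mul_nonneg ht0 asymptoticVariance_nonneg)
  have hex' : ∀ {U : Space 1 → ℝ}, IsAdmissible Factor.line V f U →
      ∃ p : (Space 1 → ℝ) × (Space 1 → Space 1),
        IsPoissonSolution Factor.line V f U p.1 p.2 := fun hU => by
    obtain ⟨u, g, h⟩ := (hU.wellPosed_poisson hVf).1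
    exact ⟨(u, g), h⟩
  have hW₀ := h₀.isPotential hVf
  have hW₁ := h₁.isPotential hVf
  have hWe : V + ((1 - t) • U₀ + t • U₁) =
      fun x => (1 - t) * (V + U₀) x + t * (V + U₁) x := by
    ext x
    simp only [Pi.add_apply, Pi.smul_apply, smul_eq_mul]
    ring
  have hW : IsPotential Factor.line (V + ((1 - t) • U₀ + t • U₁)) := by
    rw [hWe]; exact hW₀.convex_combination hW₁ ht0 ht1
  obtain ⟨u, g, hs, e⟩ := exists_asymptoticVariance_eq hex
  obtain ⟨u₀, g₀, hs₀, e₀⟩ := exists_asymptoticVariance_eq (hex' h₀)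
  obtain ⟨u₁, g₁, hs₁, e₁⟩ := exists_asymptoticVariance_eq (hex' h₁)
  -- All three energies are written with the flux of `g₀`, so that a single nonnegative weight `J²`
  -- appears in the convexity inequality.
  obtain ⟨j, E⟩ := energy_eq_integral_flux hW hs.1.1.4 (flux_ae_eq hVf hW hW₀ hs hs₀)
  obtain ⟨j₀, E₀⟩ := energy_eq_integral_flux hW₀ hs₀.1.1.4 Filter.EventuallyEq.rfl
  obtain ⟨j₁, E₁⟩ := energy_eq_integral_flux hW₁ hs₁.1.1.4 (flux_ae_eq hVf hW₁ hW₀ hs₁ hs₀)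
  rw [e, e₀, e₁, E, E₀, E₁]
  have i := hW.2
  unfold partitionFunction
  simp only [hWe] at i j ⊢
  have key := integral_mul_integral_convex (ν := Factor.line.leb 1) ht0 ht1
    (fun x => sq_nonneg (flux (V + U₀) g₀ x)) hW₀.2 hW₁.2 i j₀ j₁ j
  have hpos : 0 ≤ 2 / (∫ x, Real.exp (-V x) ∂(Factor.line.leb 1)) ^ 2 := by positivity
  have := mul_le_mul_of_nonneg_left key hpos
  refine this.trans (le_of_eq ?_)
  simp only [Factor.leb]
  ring

end

theorem mainTheorem5 {d : ℕ} (D : Factor) (V f : Space d → ℝ) (hVf : IsTargetPair D V f) :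
    (∀ U : Space d → ℝ, IsAdmissible D V f U →
      WellPosed D (V + U) (poissonSource D V f U) ∧
      ∀ (φ : Space d → ℝ) (gφ : Space d → Space d), IsPoissonSolution D V f U φ gφ →
        (∀ δX : Space d → ℝ, D.IsTest δX →
          WellPosed D (V + U) (perturbedSource D V f U gφ (centre D V U δX))) ∧
        ∀ δU δW : Space d → ℝ, D.IsTest δU → D.IsTest δW →
          (∀ ε : ℝ, LineDifferentiableAt ℝ (asymptoticVariance D V f) (U + ε • δW) δU) ∧
          ∀ (ψU ψW : Space d → ℝ) (gU gW : Space d → Space d),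
            IsWeakSolution D (V + U)
              (perturbedSource D V f U gφ (centre D V U δU)) ψU gU →
            IsWeakSolution D (V + U)
              (perturbedSource D V f U gφ (centre D V U δW)) ψW gW →
            HasLineDerivAt ℝ
              (fun U' : Space d → ℝ => 1 / 2 * lineDeriv ℝ (asymptoticVariance D V f) U' δU)
              (weightedTerm D V U gφ (centre D V U δU) (centre D V U δW) -
                gradientTerm D V U gφ (centre D V U δU) (centre D V U δW) gU gW) U δW ∧
            (D = Factor.line → d = 1 →
              gradientTerm D V U gφ (centre D V U δU) (centre D V U δW) gU gW = 0)) ∧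
    (D = Factor.line → d = 1 →
      ∀ U₀ U₁ : Space d → ℝ, IsAdmissible D V f U₀ → IsAdmissible D V f U₁ →
        ∀ t : ℝ, 0 ≤ t → t ≤ 1 →
          asymptoticVariance D V f ((1 - t) • U₀ + t • U₁) ≤
            (1 - t) * asymptoticVariance D V f U₀ + t * asymptoticVariance D V f U₁) := by
  constructor
  · intro U hU
    refine ⟨hU.wellPosed_poisson hVf, fun φ gφ hφ => ⟨fun δX hX =>
      hU.wellPosed_perturbed hVf hφ hX, fun δU δW hδU hδW => ⟨fun ε =>
        hU.lineDifferentiableAt hVf hδU hδW ε, fun ψU ψW gU gW hψU hψW =>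
          ⟨hU.hasLineDerivAt_lineDeriv hVf hφ hδU hδW hψU hψW, fun hD hd => ?_⟩⟩⟩⟩
    subst hD hd
    exact gradientTerm_eq_zero hVf hU hφ hδU hψU
  · intro hD hd U₀ U₁ h₀ h₁ t ht0 ht1
    subst hD hd
    exact asymptoticVariance_convex hVf h₀ h₁ ht0 ht1
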